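/- Let $p$ be an odd prime, let $\Gamma$ be a cyclic group of order $p^3$, let $\Gamma_2\subset\Gamma$ be its subgroup of order $p^2$, and let $r,\delta\ge 0$ be integers. For a number field $F$ write $\mu_F$ for its group of roots of unity and $\mathcal{E}_F=\mathbb{Z}_p\otimes_{\mathbb{Z}}(\mathcal{O}_F^\times/\mu_F)$. Consider all cyclic extensions of number fields $L_3/L$ of degree $p^3$ with an identification $\mathrm{Gal}(L_3/L)\cong\Gamma$ such that - $N_{L_3/L}(\mu_{L_3})=\mu_L$, - exactly $r=r_{3,0}$ finite primes of $L$ ramify in $L_3$, - the class group $\mathrm{Cl}_L$ has $p$-rank $\dim_{\mathbb{F}_p}(\mathrm{Cl}_L/p)=\delta=\delta_0$. For each of them $H^1(\Gamma_2,\mathcal{E}_{L_3})$ is a $(\mathbb{Z}/p^2)[\Gamma/\Gamma_2]$-module, where $\Gamma/\Gamma_2$ acts by conjugation. Let $n_2$ be the number of isomorphism classes of $(\mathbb{Z}/p^2)[\Gamma/\Gamma_2]$-modules that arise in this way. Then $n_2$ is finite and $$n_2\;\le\; p^{\,p\,(6r_{3,0}+4\delta_0)^2}\cdot\binom{6r_{3,0}+4\delta_0+p}{p}^2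 .$$ -/

import Mathlib

open scoped NumberField TensorProduct
open CategoryTheory

noncomputable section

namespace GaloisUnits

/-! ### The first cohomology of a normal subgroup as a module over the quotient group -/

section Cohomology

variable {k G : Type} [CommRing k] [Group G]

/-- For `A : Rep k G` and a normal subgroup `S` of `G`, the group `H¹(S, A)`. -/
abbrev H1Sub (A : Rep.{0} k G) (S : Subgroup G) : Type :=
  groupCohomology.H1 (Rep.res S.subtype A)

theorem card_nsmul_H1_eq_zero (A : Rep.{0} k G) (S : Subgroup G) {m : ℕ} [NeZero m] (hS : Nat.card S = m) (x : H1Sub A S) :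
    m • x = 0 := by
  have : Finite S := Nat.finite_of_card_ne_zero (hS ▸ NeZero.ne m)
  have := Fintype.ofFinite S
  induction x using groupCohomology.H1_induction_on with
  | h f =>
    rw [← map_nsmul, groupCohomology.H1π_eq_zero_iff]
    refine ⟨-∑ s : S, f s, ?_⟩
    funext t
    have hf := (groupCohomology.mem_cocycles₁_iff (f : S → A)).1 f.2
    change A.ρ (t : G) (-∑ s : S, f s) - (-∑ s : S, f s) = m • f t
    have h1 : ∑ s : S, f s = ∑ s : S, f (t * s) :=
      (Equiv.sum_comp (Equiv.mulLeft t) fun s ↦ f s).symm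
    have h2 : ∑ s : S, f (t * s) = A.ρ (t : G) (∑ s : S, f s) + m • f t := by
      rw [map_sum]
      calc ∑ s : S, f (t * s) = ∑ s : S, (A.ρ (t : G) (f s) + f t) :=
            Finset.sum_congr rfl fun s _ ↦ hf t s
        _ = _ := by
            rw [Finset.sum_add_distrib, Finset.sum_const, Finset.card_univ,
              ← Nat.card_eq_fintype_card, hS]
    rw [map_neg, sub_neg_eq_add, neg_add_eq_sub, sub_eq_iff_eq_add, add_comm, ← h2, ← h1]

variable (A : Rep.{0} k G) (S : Subgroup G) [S.Normal]

/-- The map `a ↦ g • a` from `A` to `A`; it is compatible with the automorphism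
`s ↦ g⁻¹ * s * g` of `S`. -/
def conjHom (g : G) :
    Rep.res (MulAut.conjNormal g⁻¹ : MulAut S).toMonoidHom (Rep.res S.subtype A) ⟶
      Rep.res S.subtype A :=
  Rep.ofHom ⟨A.ρ g, fun s ↦ by
    ext a
    change A.ρ g (A.ρ ((MulAut.conjNormal g⁻¹ s : S) : G) a) = A.ρ (s : G) (A.ρ g a)
    rw [← Module.End.mul_apply, ← Module.End.mul_apply, ← map_mul, ← map_mul,
      MulAut.conjNormal_apply]
    congr 2
    group⟩

/-- The conjugation action of `g : G` on `H¹(S, A)`: the class of a cocycle `f` is sent to the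
class of `s ↦ g • f (g⁻¹ * s * g)`. -/
def conjH1 (g : G) : H1Sub A S →ₗ[k] H1Sub A S :=
  (groupCohomology.map (MulAut.conjNormal g⁻¹ : MulAut S).toMonoidHom (conjHom A S g) 1).hom

/-- The conjugation action on cocycles. -/
def conjCocycle (g : G) (f : groupCohomology.cocycles₁ (Rep.res S.subtype A)) :
    groupCohomology.cocycles₁ (Rep.res S.subtype A) :=
  groupCohomology.mapCocycles₁ (MulAut.conjNormal g⁻¹ : MulAut S).toMonoidHom (conjHom A S g) f

theorem conjCocycle_apply (g : G) (f : groupCohomology.cocycles₁ (Rep.res S.subtype A)) (s : S) :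
    (conjCocycle A S g f) s = A.ρ g (f (MulAut.conjNormal g⁻¹ s)) := rfl

theorem conjH1_π (g : G) (f : groupCohomology.cocycles₁ (Rep.res S.subtype A)) :
    conjH1 A S g (groupCohomology.H1π _ f) = groupCohomology.H1π _ (conjCocycle A S g f) := by
  have := groupCohomology.H1π_comp_map_apply
    (MulAut.conjNormal g⁻¹ : MulAut S).toMonoidHom (conjHom A S g) f
  exact this

/-- The conjugation action of `G` on `H¹(S, A)`. -/
def conjRep : Representation k G (H1Sub A S) where
  toFun := conjH1 A S
  map_one' := by
    ext x
    induction x using groupCohomology.H1_induction_on with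
    | h f =>
      rw [conjH1_π, Module.End.one_apply]
      refine congrArg (groupCohomology.H1π (Rep.res S.subtype A))
        (groupCohomology.cocycles₁_ext fun s ↦ ?_)
      rw [conjCocycle_apply]
      simp
  map_mul' g h := by
    ext x
    induction x using groupCohomology.H1_induction_on with
    | h f =>
      rw [Module.End.mul_apply, conjH1_π, conjH1_π, conjH1_π]
      refine congrArg (groupCohomology.H1π (Rep.res S.subtype A))
        (groupCohomology.cocycles₁_ext fun s ↦ ?_)
      rw [conjCocycle_apply, conjCocycle_apply, conjCocycle_apply]
      simp

theorem conjRep_eq_one_of_mem (g : G) (hg : g ∈ S) : conjRep A S g = 1 := by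
  ext x
  induction x using groupCohomology.H1_induction_on with
  | h f =>
    change conjH1 A S g _ = _
    rw [conjH1_π, Module.End.one_apply, groupCohomology.H1π_eq_iff]
    refine ⟨f ⟨g, hg⟩, ?_⟩
    funext s
    have hf := (groupCohomology.mem_cocycles₁_iff (f : S → A)).1 f.2
    set t : S := ⟨g, hg⟩ with ht
    have hconj : MulAut.conjNormal g⁻¹ s = t⁻¹ * s * t := by
      ext; simp [ht]
    have h1 : f (s * t) = A.ρ (s : G) (f t) + f s := hf s t
    have h2 : f (t * (t⁻¹ * s * t)) = A.ρ g (f (t⁻¹ * s * t)) + f t := hf t _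
    have h3 : t * (t⁻¹ * s * t) = s * t := by group
    rw [h3, h1] at h2
    change A.ρ (s : G) (f t) - f t = A.ρ g (f (MulAut.conjNormal g⁻¹ s)) - f s
    rw [hconj, sub_eq_sub_iff_add_eq_add, h2]

/-- The action of `G ⧸ S` on `H¹(S, A)` induced by the conjugation action of `G`. -/
def quotientConjRep : Representation k (G ⧸ S) (H1Sub A S) :=
  QuotientGroup.lift S (conjRep A S) (conjRep_eq_one_of_mem A S)

/-- If `S` has order `m`, then `H¹(S, A)` is killed by `m`, hence is a `ℤ/m`-module. -/
@[reducible] def zmodModuleH1 {m : ℕ} [NeZero m] (hS : Nat.card S = m) :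
    Module (ZMod m) (H1Sub A S) :=
  AddCommGroup.zmodModule (card_nsmul_H1_eq_zero A S hS)

/-- The action of `G ⧸ S` on `H¹(S, A)`, as a `ℤ/m`-linear representation, for `m = |S|`. -/
def zmodRepH1 {m : ℕ} [NeZero m] (hS : Nat.card S = m) :
    letI := zmodModuleH1 A S hS
    Representation (ZMod m) (G ⧸ S) (H1Sub A S) :=
  letI := zmodModuleH1 A S hS
  { toFun := fun g ↦ (quotientConjRep A S g).toAddMonoidHom.toZModLinearMap m
    map_one' := by ext x; simp
    map_mul' := fun g h ↦ by ext x; simp }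

/-- `H¹(S, A)` as a module over the group ring `(ℤ/m)[G ⧸ S]`, for `m = |S|`. -/
def moduleH1 {m : ℕ} [NeZero m] (hS : Nat.card S = m) :
    ModuleCat.{0} (MonoidAlgebra (ZMod m) (G ⧸ S)) :=
  letI := zmodModuleH1 A S hS
  ModuleCat.of (MonoidAlgebra (ZMod m) (G ⧸ S)) (zmodRepH1 A S hS).asModule

end Cohomology

/-! ### Units, ramified primes and class groups -/

section Arithmetic

set_option maxSynthPendingDepth 3

variable (L F : Type) [Field L] [NumberField L] [Field F] [NumberField F] [Algebra L F]

/-- The group `E_F = 𝓞_F^× / μ_F` of units modulo roots of unity, written additively. -/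
abbrev UnitsModTorsion : Type := Additive ((𝓞 F)ˣ ⧸ NumberField.Units.torsion F)

variable {L F} in
/-- The automorphism of `𝓞_F^×` induced by an element of the Galois group. -/
def galUnits (σ : Gal(F/L)) : (𝓞 F)ˣ →* (𝓞 F)ˣ :=
  Units.map (MulSemiringAction.toRingHom Gal(F/L) (𝓞 F) σ : 𝓞 F →* 𝓞 F)

variable {L F} in
/-- The endomorphism of `E_F` induced by an element of the Galois group. -/
def galUnitsModTorsion (σ : Gal(F/L)) : UnitsModTorsion F →ₗ[ℤ] UnitsModTorsion F :=
  (MonoidHom.toAdditive (QuotientGroup.map (NumberField.Units.torsion F)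
    (NumberField.Units.torsion F) (galUnits σ)
    (fun _ hu ↦ MonoidHom.isOfFinOrder (galUnits σ) hu))).toIntLinearMap

variable (p : ℕ) [Fact p.Prime]

/-- The `ℤ_p[Gal(F/L)]`-module `𝓔_F = ℤ_p ⊗ E_F`. -/
def unitRep : Representation ℤ_[p] Gal(F/L) (ℤ_[p] ⊗[ℤ] UnitsModTorsion F) where
  toFun σ := (galUnitsModTorsion σ).baseChange ℤ_[p]
  map_one' := by
    rw [← LinearMap.baseChange_one]
    congr 1
    ext x
    induction x using Additive.rec with
    | ofMul x =>
      induction x using QuotientGroup.induction_on with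
      | H u =>
        change Additive.ofMul (QuotientGroup.mk (galUnits (1 : Gal(F/L)) u)) = _
        congr 2
  map_mul' σ τ := by
    rw [← LinearMap.baseChange_mul]
    congr 1
    ext x
    induction x using Additive.rec with
    | ofMul x =>
      induction x using QuotientGroup.induction_on with
      | H u =>
        change Additive.ofMul (QuotientGroup.mk (galUnits (σ * τ) u)) =
          Additive.ofMul (QuotientGroup.mk (galUnits σ (galUnits τ u)))
        congr 2

variable {L F} in
/-- `𝓔_F` as a representation of `Γ`, via an identification of `Γ` with `Gal(F/L)`. -/
def unitRepOf {Γ : Type} [Group Γ] (φ : Γ ≃* Gal(F/L)) : Rep.{0} ℤ_[p] Γ :=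
  Rep.of ((unitRep L F p).comp φ.toMonoidHom)

/-- The set `R_{F/L}` of finite primes of `L` that ramify in `F`. -/
def ramifiedPrimes : Set (IsDedekindDomain.HeightOneSpectrum (𝓞 L)) :=
  {v | ∃ P : Ideal (𝓞 F), P.IsPrime ∧ P.LiesOver v.asIdeal ∧ P.ramificationIdx (𝓞 L) ≠ 1}

/-- The `p`-rank `dim_{𝔽_p} (Cl_L / p)` of the ideal class group of `L`. -/
def classGroupRank : ℕ :=
  Module.finrank (ZMod p) (ModN (Additive (ClassGroup (𝓞 L))) p)

/-- The condition `N_{F/L}(μ_F) = μ_L`. -/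
def NormTorsionEq : Prop :=
  (NumberField.Units.torsion F).map (Units.map (RingOfIntegers.norm L)) =
    NumberField.Units.torsion L

end Arithmetic

/-! ### The possible module structures -/

/-- Let `S` be a normal subgroup of order `m` of a finite group `Γ`. This is the set of isomorphism
classes of `(ℤ/m)[Γ ⧸ S]`-modules `H¹(S, 𝓔_F)`, where `F/L` runs over all Galois extensions of
number fields together with an identification `Γ ≃ Gal(F/L)` such that `N_{F/L}(μ_F) = μ_L`,
exactly `r` finite primes of `L` ramify in `F`, and `Cl_L` has `p`-rank `δ`.
(Number fields are countable, so nothing is lost by taking them in `Type`.) -/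
def possibleH1Structures (p : ℕ) [Fact p.Prime] {Γ : Type} [Group Γ] (S : Subgroup Γ) [S.Normal]
    {m : ℕ} [NeZero m] (hS : Nat.card S = m) (r δ : ℕ) :
    Set (Quotient (isIsomorphicSetoid (ModuleCat.{0} (MonoidAlgebra (ZMod m) (Γ ⧸ S))))) :=
  {c | ∃ (L F : Type) (_ : Field L) (_ : NumberField L) (_ : Field F) (_ : NumberField F)
      (_ : Algebra L F) (_ : IsGalois L F) (φ : Γ ≃* Gal(F/L)),
      NormTorsionEq L F ∧ (ramifiedPrimes L F).ncard = r ∧ classGroupRank L p = δ ∧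
      c = Quotient.mk _ (moduleH1 (unitRepOf p φ) S hS)}

end GaloisUnits

end

noncomputable section

namespace GaloisUnits

/-! ### Counting modules over the group ring of a group of order `p` -/

section Counting

/-! Put `G = Γ/Γ₂`, of order `p`, `R = (ℤ/p²)[G]`, and `M = H¹(Γ₂, 𝓔)`. The proof bounds the socle
of `M` (the elements killed by `p` and fixed by `G`) and then counts modules with such a socle.

Counting. `ℤ/p²` is self-injective, so functionals separating a socle of order at most `p^s` extend
to `M` and induce a map `M → R^s`. It is injective because every nonzero submodule meets the socle.
Ideals of `R` need two generators, so submodules of `R^s` need `2s`, and there are at most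
`|R|^(s·2s) = p^(p(2s)²)` classes (`ncard_isoClasses_le`).

Socle. Let `σ` generate `Γ`, `x = σ - 1`, `T` the sum of `σ^i` for `i < p`, and `S` the norm of `Γ₂
= ⟨σ^p⟩`; then `xT = σ^p - 1` and, for `A = 𝓔`, `H¹(Γ₂, A) = ker S / xTA`. Cutting the socle along
`TA` bounds its order by `|Ĥ⁰(G, A^Γ₂)| · |H¹(Γ, A)/p|` (`relIndex_socle_le`). As `p` is odd,
infinite places are unramified, so `rank A^Γ₂ ≥ p · rank A^Γ`. A Herbrand quotient argument gives
`|Ĥ⁰(G, A^Γ₂)| ≤ |H¹(G, A^Γ₂)|`, and inflation into `H¹(Γ, A)[p]` bounds this by `|H¹(Γ, A)/p|`.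
Hence the socle has order at most `|H¹(Γ, A)/p|²`.

Arithmetic. The condition on roots of unity makes `H¹` of the units modulo torsion a quotient of
`H¹(Γ, 𝓞_F^×)`. By Hilbert 90 the latter consists of elements with Galois-invariant divisor modulo
`L^× 𝓞_F^×`. Its `p`-torsion is controlled by the orders modulo ramification indices and by
`Cl_L[p]`, so it has at most `p^(r+δ)` elements (`relIndex_units_le`). Thus `s = 2(r+δ)` works, and
`2s ≤ 6r + 4δ`. -/

theorem baer_zmod (n : ℕ) [NeZero n] : Module.Baer (ZMod n) (ZMod n) := by
  intro I f
  obtain ⟨d, hd⟩ := (IsPrincipalIdealRing.principal (I.comap (Int.castRingHom (ZMod n)))).principal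
  have hdI : ((d : ℤ) : ZMod n) ∈ I := by
    have : d ∈ I.comap (Int.castRingHom (ZMod n)) := hd ▸ Submodule.mem_span_singleton_self d
    simpa using this
  have hnI : (n : ℤ) ∈ I.comap (Int.castRingHom (ZMod n)) := by simp
  obtain ⟨e, he⟩ : ∃ e, e * d = (n : ℤ) := by
    rw [hd] at hnI
    exact Submodule.mem_span_singleton.1 hnI
  have hn0 : (n : ℤ) ≠ 0 := by exact_mod_cast NeZero.ne n
  obtain ⟨y, hy⟩ := ZMod.intCast_surjective (f ⟨d, hdI⟩)
  -- The ideal is generated by `d` with `n = e d`. Since `e y = 0` modulo `n = e d`, `d` divides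
  -- `y`, and multiplication by `y / d` extends `f`.
  have hey : ((e * y : ℤ) : ZMod n) = 0 := by
    have : ((e : ℤ) : ZMod n) • f ⟨d, hdI⟩ = 0 := by
      rw [← map_smul]
      have : ((e : ℤ) : ZMod n) • (⟨d, hdI⟩ : I) = 0 := by
        ext
        change ((e : ℤ) : ZMod n) * ((d : ℤ) : ZMod n) = 0
        rw [← Int.cast_mul, he]
        simp
      rw [this, map_zero]
    rw [← hy] at this
    simpa using this
  have hdy : d ∣ y := by
    rw [ZMod.intCast_zmod_eq_zero_iff_dvd, ← he] at hey
    exact Int.dvd_of_mul_dvd_mul_left (fun h ↦ hn0 (by rw [← he, h, zero_mul])) hey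
  obtain ⟨z, rfl⟩ := hdy
  refine ⟨LinearMap.toSpanSingleton (ZMod n) (ZMod n) (z : ZMod n), fun x hx ↦ ?_⟩
  obtain ⟨t, rfl⟩ := ZMod.intCast_surjective x
  have ht : t ∈ I.comap (Int.castRingHom (ZMod n)) := by simpa using hx
  rw [hd] at ht
  obtain ⟨w, rfl⟩ := Submodule.mem_span_singleton.1 ht
  have : (⟨((w • d : ℤ) : ZMod n), hx⟩ : I) = ((w : ℤ) : ZMod n) • ⟨d, hdI⟩ := by
    ext; simp
  rw [this, map_smul, ← hy]
  simp [mul_assoc]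

variable (p : ℕ) [Fact p.Prime]

theorem exists_coordinates (W : Type) [AddCommGroup W] [Module (ZMod p) W] [Finite W] (s : ℕ)
    (hW : Nat.card W ≤ p ^ s) :
    ∃ f : Fin s → (W →+ ZMod p), ∀ w, (∀ i, f i w = 0) → w = 0 := by
  have hp : p.Prime := Fact.out
  let b := Module.finBasis (ZMod p) W
  have hd : Module.finrank (ZMod p) W ≤ s := by
    have := Module.natCard_eq_pow_finrank (K := ZMod p) (V := W)
    rw [this, Nat.card_zmod] at hW
    exact (Nat.pow_le_pow_iff_right hp.one_lt).1 hW
  -- Indices beyond the dimension carry the zero functional, as the dimension may be smaller than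
  -- `s`.
  refine ⟨fun i ↦ if h : i.1 < Module.finrank (ZMod p) W then
    (b.coord ⟨i, h⟩).toAddMonoidHom else 0, fun w h ↦ ?_⟩
  refine b.forall_coord_eq_zero_iff.1 fun i ↦ ?_
  simpa using h ⟨i, i.2.trans_le hd⟩

/-- A subgroup of order at most `p ^ s` that is killed by `p` is separated by `s` functionals with
values in `ℤ/p²`. -/
theorem exists_functionals {M : Type} [AddCommGroup M] [Module (ZMod (p ^ 2)) M]
    (V : Submodule (ZMod (p ^ 2)) M) (hpV : ∀ v ∈ V, p • v = 0) (s : ℕ) [Finite V]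
    (hV : Nat.card V ≤ p ^ s) :
    ∃ f : Fin s → (M →ₗ[ZMod (p ^ 2)] ZMod (p ^ 2)), ∀ v ∈ V, (∀ i, f i v = 0) → v = 0 := by
  have hp : p.Prime := Fact.out
  let : Module (ZMod p) V := AddCommGroup.zmodModule (n := p) fun x ↦ by
    ext; simpa using hpV x x.2
  obtain ⟨c, hc⟩ := exists_coordinates p V s hV
  -- Multiplication by `p` embeds `ℤ/p` in `ℤ/p²`, turning `𝔽_p`-functionals on `V` into
  -- `ℤ/p²`-linear ones.
  let j : ZMod p →+ ZMod (p ^ 2) :=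
    ZMod.lift p ⟨zmultiplesHom _ (p : ZMod (p ^ 2)), by
      rw [zmultiplesHom_apply, natCast_zsmul, nsmul_eq_mul, ← Nat.cast_mul, ← sq]
      exact ZMod.natCast_self _⟩
  have hj : Function.Injective j := by
    rw [ZMod.lift_injective]
    intro m hm
    rw [zmultiplesHom_apply, zsmul_eq_mul] at hm
    have h2 : ((m * p : ℤ) : ZMod (p ^ 2)) = 0 := by push_cast; exact hm
    rw [ZMod.intCast_zmod_eq_zero_iff_dvd] at h2
    rw [ZMod.intCast_zmod_eq_zero_iff_dvd]
    push_cast at h2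
    rw [sq] at h2
    exact Int.dvd_of_mul_dvd_mul_right (by exact_mod_cast hp.ne_zero) h2
  let f0 : Fin s → (V →ₗ[ZMod (p ^ 2)] ZMod (p ^ 2)) := fun i ↦
    (j.comp (c i)).toZModLinearMap (p ^ 2)
  have hext : ∀ i, ∃ h : M →ₗ[ZMod (p ^ 2)] ZMod (p ^ 2), h ∘ₗ V.subtype = f0 i := fun i ↦
    (baer_zmod (p ^ 2)).extension_property _ (Submodule.injective_subtype _) _
  choose F hF using hext
  refine ⟨F, fun v hv h ↦ ?_⟩
  have h0 : ∀ i, c i ⟨v, hv⟩ = 0 := fun i ↦ by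
    have h2 : f0 i ⟨v, hv⟩ = 0 := by rw [← hF]; exact h i
    exact hj (by rw [map_zero]; exact h2)
  simpa using hc _ h0

variable {p} {G : Type} [CommGroup G] [Finite G]

/-- The linear map to the group ring attached to a functional. -/
def toGroupRing {k : Type} [CommRing k] {M : Type} [AddCommGroup M] [Module k M]
    [Module (MonoidAlgebra k G) M]
    [IsScalarTower k (MonoidAlgebra k G) M] (f : M →ₗ[k] k) :
    M →ₗ[MonoidAlgebra k G] MonoidAlgebra k G :=
  letI := Fintype.ofFinite G
  -- The map is `m ↦ ∑ h, f(h⁻¹ m) h`; its coefficient at `1` recovers `f`.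
  letI F : M →ₗ[k] MonoidAlgebra k G :=
    ∑ h : G, (MonoidAlgebra.lsingle h) ∘ₗ f ∘ₗ
      (LinearMap.lsmul (MonoidAlgebra k G) M (MonoidAlgebra.single h⁻¹ 1)).restrictScalars k
  { toFun := F
    map_add' := map_add F
    map_smul' := fun a m ↦ by
      induction a using MonoidAlgebra.induction_linear with
      | zero => simp
      | add a b ha hb => rw [add_smul, map_add, ha, hb, RingHom.id_apply, RingHom.id_apply,
          RingHom.id_apply, add_smul]
      | single x r =>
        have h1 : (MonoidAlgebra.single x r : MonoidAlgebra k G) =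
            r • MonoidAlgebra.single x 1 := by simp
        rw [h1, smul_assoc, map_smul, RingHom.id_apply, smul_assoc]
        congr 1
        simp only [F, LinearMap.sum_apply, LinearMap.comp_apply, LinearMap.restrictScalars_apply,
          LinearMap.lsmul_apply, MonoidAlgebra.lsingle_apply, smul_eq_mul, Finset.mul_sum,
          MonoidAlgebra.single_mul_single, one_mul, ← mul_smul]
        refine (Equiv.sum_comp (Equiv.mulLeft x) _).symm.trans (Finset.sum_congr rfl fun h _ ↦ ?_)
        simp }

theorem apply_eq_zero_of_toGroupRing {k : Type} [CommRing k] {M : Type} [AddCommGroup M]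
    [Module k M] [Module (MonoidAlgebra k G) M] [IsScalarTower k (MonoidAlgebra k G) M]
    (f : M →ₗ[k] k) (m : M) (h : toGroupRing (G := G) f m = 0) : f m = 0 := by
  let := Fintype.ofFinite G
  have h1 := congrArg (fun x : MonoidAlgebra k G ↦ x.coeff 1) h
  classical
  simp only [toGroupRing, LinearMap.coe_mk, AddHom.coe_mk, LinearMap.sum_apply,
    LinearMap.comp_apply, LinearMap.restrictScalars_apply, LinearMap.lsmul_apply,
    MonoidAlgebra.lsingle_apply, MonoidAlgebra.coeff_sum, Finsupp.finsetSum_apply,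
    MonoidAlgebra.coeff_single, Finsupp.single_apply] at h1
  rw [Finset.sum_ite_eq' Finset.univ (1 : G)] at h1
  simpa [← MonoidAlgebra.one_def] using h1

-- Expanding `g^p = ((g - 1) + 1)^p = 1` modulo `p` shows that `g - 1` is nilpotent on elements
-- killed by `p`.
omit [Finite G] in
theorem exists_sub_one_pow_eq {k : Type} [CommRing k] (hG : Nat.card G = p) (g : G) :
    ∃ r : MonoidAlgebra k G, (MonoidAlgebra.single g 1 - 1 : MonoidAlgebra k G) ^ p = p * r := by
  obtain ⟨r, hr⟩ := exists_add_pow_prime_eq (Fact.out : p.Prime)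
    (MonoidAlgebra.single g 1 - 1 : MonoidAlgebra k G) 1
  rw [sub_add_cancel, MonoidAlgebra.single_pow, ← hG, pow_card_eq_one', one_pow, one_pow,
    ← MonoidAlgebra.one_def, hG] at hr
  refine ⟨-((MonoidAlgebra.single g 1 - 1 : MonoidAlgebra k G) * r), ?_⟩
  linear_combination -hr

omit [Finite G] in
/-- A nonzero submodule of a `(ℤ/p²)[G]`-module contains a nonzero element that is killed by `p`
and fixed by `g`. -/
theorem exists_mem_socle (hG : Nat.card G = p) (g : G) {M : Type} [AddCommGroup M]
    [Module (MonoidAlgebra (ZMod (p ^ 2)) G) M]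
    (K : Submodule (MonoidAlgebra (ZMod (p ^ 2)) G) M) (hK : K ≠ ⊥) :
    ∃ m ∈ K, m ≠ 0 ∧ p • m = 0 ∧
      (MonoidAlgebra.single g 1 : MonoidAlgebra (ZMod (p ^ 2)) G) • m = m := by
  obtain ⟨m₀, hm₀, hne⟩ := (Submodule.ne_bot_iff K).1 hK
  obtain ⟨m, hm, hm0, hpm⟩ : ∃ m ∈ K, m ≠ 0 ∧ p • m = 0 := by
    by_cases h : p • m₀ = 0
    · exact ⟨m₀, hm₀, hne, h⟩
    · refine ⟨p • m₀, K.nsmul_mem hm₀ p, h, ?_⟩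
      rw [← mul_nsmul, ← sq,
        ← Nat.cast_smul_eq_nsmul (MonoidAlgebra (ZMod (p ^ 2)) G)]
      have : ((p ^ 2 : ℕ) : MonoidAlgebra (ZMod (p ^ 2)) G) = 0 := by
        rw [← map_natCast (algebraMap (ZMod (p ^ 2)) (MonoidAlgebra (ZMod (p ^ 2)) G)),
          ZMod.natCast_self, map_zero]
      rw [this, zero_smul]
  set x : MonoidAlgebra (ZMod (p ^ 2)) G := MonoidAlgebra.single g 1 - 1 with hx
  obtain ⟨r, hr⟩ := exists_sub_one_pow_eq (k := ZMod (p ^ 2)) hG g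
  have hex : ∃ n, x ^ n • m = 0 := ⟨p, by
    rw [hr, mul_comm, mul_smul, Nat.cast_smul_eq_nsmul, hpm, smul_zero]⟩
  classical
  set n := Nat.find hex with hn
  have hn1 : x ^ n • m = 0 := Nat.find_spec hex
  have hnpos : n ≠ 0 := fun h ↦ hm0 (by simpa [h] using hn1)
  obtain ⟨l, hl⟩ := Nat.exists_eq_succ_of_ne_zero hnpos
  -- The last nonzero `(g - 1)^l m` is fixed by `g`.
  refine ⟨x ^ l • m, K.smul_mem _ hm, Nat.find_min hex (by omega), ?_, ?_⟩
  · rw [smul_comm, hpm, smul_zero]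
  · replace hn1 : x ^ (l + 1) • m = 0 := (congrArg (fun i ↦ x ^ i • m) hl).symm.trans hn1
    have h3 : x ^ (l + 1) = x * x ^ l := pow_succ' x l
    rw [h3, mul_smul, hx, sub_smul, one_smul, sub_eq_zero] at hn1
    exact hn1

/-- A nonzero kernel would contain a nonzero socle element, yet the functionals used to build the
map separate the socle. -/
theorem exists_injective_pi (hG : Nat.card G = p) (g : G) {M : Type} [AddCommGroup M]
    [Module (MonoidAlgebra (ZMod (p ^ 2)) G) M] (s : ℕ)
    (hfin : {m : M | p • m = 0 ∧
      (MonoidAlgebra.single g 1 : MonoidAlgebra (ZMod (p ^ 2)) G) • m = m}.Finite)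
    (hcard : {m : M | p • m = 0 ∧
      (MonoidAlgebra.single g 1 : MonoidAlgebra (ZMod (p ^ 2)) G) • m = m}.ncard ≤ p ^ s) :
    ∃ f : M →ₗ[MonoidAlgebra (ZMod (p ^ 2)) G] (Fin s → MonoidAlgebra (ZMod (p ^ 2)) G),
      Function.Injective f := by
  let : Module (ZMod (p ^ 2)) M :=
    Module.compHom M (algebraMap (ZMod (p ^ 2)) (MonoidAlgebra (ZMod (p ^ 2)) G))
  have : IsScalarTower (ZMod (p ^ 2)) (MonoidAlgebra (ZMod (p ^ 2)) G) M :=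
    IsScalarTower.of_algebraMap_smul fun _ _ ↦ rfl
  let V : Submodule (ZMod (p ^ 2)) M :=
    { carrier := {m : M | p • m = 0 ∧
        (MonoidAlgebra.single g 1 : MonoidAlgebra (ZMod (p ^ 2)) G) • m = m}
      add_mem' := fun {a b} ha hb ↦ ⟨by rw [smul_add, ha.1, hb.1, add_zero],
        by rw [smul_add, ha.2, hb.2]⟩
      zero_mem' := ⟨smul_zero _, smul_zero _⟩
      smul_mem' := fun c a ha ↦ ⟨by rw [smul_comm, ha.1, smul_zero],
        by rw [smul_comm, ha.2]⟩ }
  have : Finite V := hfin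
  obtain ⟨f, hf⟩ := exists_functionals p V (fun v hv ↦ hv.1) s hcard
  refine ⟨LinearMap.pi fun i ↦ toGroupRing (f i), ?_⟩
  rw [← LinearMap.ker_eq_bot]
  by_contra hne
  obtain ⟨m, hm, hm0, h1, h2⟩ := exists_mem_socle hG g _ hne
  refine hm0 (hf m ⟨h1, h2⟩ fun i ↦ apply_eq_zero_of_toGroupRing (G := G) (f i) m ?_)
  exact congrFun (LinearMap.mem_ker.1 hm) i

/-- For `G` finite cyclic, the group algebra is a quotient of `k[X]`. -/
theorem isPrincipalIdealRing_monoidAlgebra (k : Type) [Field k] (g : G)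
    (hg : ∀ x, x ∈ Subgroup.zpowers g) : IsPrincipalIdealRing (MonoidAlgebra k G) := by
  refine IsPrincipalIdealRing.of_surjective
    (Polynomial.aeval (R := k) (MonoidAlgebra.single g 1 : MonoidAlgebra k G)) fun a ↦ ?_
  induction a using MonoidAlgebra.induction_linear with
  | zero => exact ⟨0, map_zero _⟩
  | add a b ha hb =>
    obtain ⟨x, rfl⟩ := ha
    obtain ⟨y, rfl⟩ := hb
    exact ⟨x + y, map_add _ _ _⟩
  | single x r =>
    obtain ⟨n, rfl⟩ := Submonoid.mem_powers_iff _ _ |>.1 (mem_powers_iff_mem_zpowers.2 (hg x))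
    exact ⟨Polynomial.monomial n r, by simp [Polynomial.aeval_monomial]⟩

/-- Every ideal of `(ℤ/p²)[G]`, for `G` cyclic, is generated by two elements. -/
theorem exists_ideal_eq_span_pair (g : G) (hg : ∀ x, x ∈ Subgroup.zpowers g)
    (I : Ideal (MonoidAlgebra (ZMod (p ^ 2)) G)) : ∃ a b, I = Ideal.span {a, b} := by
  have hp : p.Prime := Fact.out
  have := isPrincipalIdealRing_monoidAlgebra (ZMod p) g hg
  have hdvd : p ∣ p ^ 2 := Dvd.intro_left _ (pow_one p ▸ (pow_succ p 1).symm)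
  let π : MonoidAlgebra (ZMod (p ^ 2)) G →+* MonoidAlgebra (ZMod p) G :=
    MonoidAlgebra.mapRingHom G (ZMod.castHom hdvd (ZMod p))
  have hπ : Function.Surjective π := by
    intro a
    induction a using MonoidAlgebra.induction_linear with
    | zero => exact ⟨0, map_zero _⟩
    | add a b ha hb =>
      obtain ⟨x, rfl⟩ := ha
      obtain ⟨y, rfl⟩ := hb
      exact ⟨x + y, map_add _ _ _⟩
    | single x r =>
      obtain ⟨t, rfl⟩ := ZMod.castHom_surjective hdvd r
      exact ⟨MonoidAlgebra.single x t, by simp [π]⟩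
  have hp2 : (p : MonoidAlgebra (ZMod (p ^ 2)) G) * p = 0 := by
    rw [← Nat.cast_mul, ← sq,
      ← map_natCast (algebraMap (ZMod (p ^ 2)) (MonoidAlgebra (ZMod (p ^ 2)) G)),
      ZMod.natCast_self, map_zero]
  have hker : ∀ a, π a = 0 → ∃ b, a = p * b := by
    intro a ha
    have hc : ∀ x, ∃ y : ZMod (p ^ 2), a.coeff x = (p : ZMod (p ^ 2)) * y := fun x ↦ by
      have h0 : ZMod.castHom hdvd (ZMod p) (a.coeff x) = 0 := by
        have := congrArg (fun z : MonoidAlgebra (ZMod p) G ↦ z.coeff x) ha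
        simpa [π] using this
      obtain ⟨t, ht⟩ := ZMod.intCast_surjective (a.coeff x)
      rw [← ht, map_intCast, ZMod.intCast_zmod_eq_zero_iff_dvd] at h0
      obtain ⟨w, rfl⟩ := h0
      exact ⟨w, by rw [← ht]; push_cast; rfl⟩
    choose y hy using hc
    have := Fintype.ofFinite G
    refine ⟨∑ x : G, MonoidAlgebra.single x (y x), ?_⟩
    rw [← nsmul_eq_mul, Finset.smul_sum]
    ext x
    classical
    simp [MonoidAlgebra.coeff_sum, Finsupp.finsetSum_apply, Finsupp.single_apply, hy]
  obtain ⟨i', hi'⟩ := (IsPrincipalIdealRing.principal (I.map π)).principal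
  have hi'm : i' ∈ I.map π := by rw [hi']; exact Submodule.mem_span_singleton_self _
  obtain ⟨i, hiI, hi⟩ := (Ideal.mem_map_iff_of_surjective π hπ).1 hi'm
  -- With `J = (I : p)`, the two generators of `I` are a lift of a generator of `I` mod `p`, and `p`
  -- times a lift of a generator of `J` mod `p`.
  let J : Ideal (MonoidAlgebra (ZMod (p ^ 2)) G) :=
    Submodule.comap (LinearMap.mulLeft (MonoidAlgebra (ZMod (p ^ 2)) G)
      (p : MonoidAlgebra (ZMod (p ^ 2)) G)) I
  obtain ⟨j', hj'⟩ := (IsPrincipalIdealRing.principal (J.map π)).principal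
  have hj'm : j' ∈ J.map π := by rw [hj']; exact Submodule.mem_span_singleton_self _
  obtain ⟨j, hjJ, hj⟩ := (Ideal.mem_map_iff_of_surjective π hπ).1 hj'm
  have hpj : (p : MonoidAlgebra (ZMod (p ^ 2)) G) * j ∈ I := hjJ
  refine ⟨i, p * j, le_antisymm (fun a ha ↦ ?_) ?_⟩
  · have h1 : π a ∈ I.map π := Ideal.mem_map_of_mem _ ha
    rw [hi'] at h1
    obtain ⟨c', hc'⟩ := Submodule.mem_span_singleton.1 h1
    obtain ⟨c, rfl⟩ := hπ c'
    obtain ⟨b, hb⟩ := hker (a - c * i) (by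
      rw [map_sub, map_mul, hi, ← hc', smul_eq_mul, sub_self])
    have hbJ : b ∈ J := by
      change (p : MonoidAlgebra (ZMod (p ^ 2)) G) * b ∈ I
      rw [← hb]
      exact I.sub_mem ha (I.mul_mem_left _ hiI)
    have h2 : π b ∈ J.map π := Ideal.mem_map_of_mem _ hbJ
    rw [hj'] at h2
    obtain ⟨d', hd'⟩ := Submodule.mem_span_singleton.1 h2
    obtain ⟨d, rfl⟩ := hπ d'
    obtain ⟨e, he⟩ := hker (b - d * j) (by
      rw [map_sub, map_mul, hj, ← hd', smul_eq_mul, sub_self])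
    refine Ideal.mem_span_pair.2 ⟨c, d, ?_⟩
    linear_combination -hb + (p : MonoidAlgebra (ZMod (p ^ 2)) G) * (-he) - e * hp2
  · rw [Ideal.span_le, Set.insert_subset_iff, Set.singleton_subset_iff]
    exact ⟨hiI, hpj⟩

theorem exists_span_eq_of_map {R M M' : Type} [CommRing R] [AddCommGroup M] [Module R M]
    [AddCommGroup M'] [Module R M'] (f : M →ₗ[R] M') (N : Submodule R M) (k l : ℕ)
    (hk : ∃ v : Fin k → M, Submodule.span R (Set.range v) = N ⊓ LinearMap.ker f)
    (hl : ∃ v : Fin l → M', Submodule.span R (Set.range v) = N.map f) :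
    ∃ v : Fin (k + l) → M, Submodule.span R (Set.range v) = N := by
  obtain ⟨v, hv⟩ := hk
  obtain ⟨w, hw⟩ := hl
  have hwm : ∀ i, ∃ x ∈ N, f x = w i := fun i ↦ by
    have : w i ∈ N.map f := hw ▸ Submodule.subset_span ⟨i, rfl⟩
    exact this
  choose w' hw'N hw' using hwm
  refine ⟨Fin.append v w', ?_⟩
  have hr : Set.range (Fin.append v w') = Set.range v ∪ Set.range w' := by
    ext x
    constructor
    · rintro ⟨i, rfl⟩
      refine Fin.addCases (fun i ↦ ?_) (fun i ↦ ?_) i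
      · simp
      · simp
    · rintro (⟨i, rfl⟩ | ⟨i, rfl⟩)
      · exact ⟨Fin.castAdd l i, by simp⟩
      · exact ⟨Fin.natAdd k i, by simp⟩
  rw [hr, Submodule.span_union, hv]
  apply le_antisymm
  · refine sup_le inf_le_left (Submodule.span_le.2 ?_)
    rintro _ ⟨i, rfl⟩
    exact hw'N i
  · intro x hx
    have h1 : f x ∈ (Submodule.span R (Set.range w')).map f := by
      rw [Submodule.map_span, ← Set.range_comp]
      have : f ∘ w' = w := funext hw'
      rw [this, hw]
      exact ⟨x, hx, rfl⟩
    obtain ⟨y, hy, hyx⟩ := h1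
    have hyN : y ∈ N := by
      refine Submodule.span_le.2 ?_ hy
      rintro _ ⟨i, rfl⟩
      exact hw'N i
    rw [← sub_add_cancel x y]
    refine Submodule.add_mem_sup ⟨N.sub_mem hx hyN, ?_⟩ hy
    simp [hyx]

/-- Induction on `n`: the first coordinates of `N` form an ideal, which costs two generators, and
the rest of `N` lies in a copy of `R^n`. -/
theorem exists_span_range_eq {R : Type} [CommRing R]
    (hR : ∀ I : Ideal R, ∃ a b, I = Ideal.span {a, b}) (n : ℕ) (N : Submodule R (Fin n → R)) :
    ∃ v : Fin (2 * n) → (Fin n → R), Submodule.span R (Set.range v) = N := by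
  induction n with
  | zero => exact ⟨fun _ ↦ 0, Subsingleton.elim _ _⟩
  | succ n ih =>
    refine exists_span_eq_of_map (LinearMap.proj 0) N (2 * n) 2 ?_ ?_
    · let ι : (Fin n → R) →ₗ[R] (Fin (n + 1) → R) :=
        { toFun := fun x ↦ Fin.cons 0 x
          map_add' := fun x y ↦ by ext i; refine Fin.cases ?_ (fun i ↦ ?_) i <;> simp
          map_smul' := fun c x ↦ by ext i; refine Fin.cases ?_ (fun i ↦ ?_) i <;> simp }
      obtain ⟨v, hv⟩ := ih (N.comap ι)
      refine ⟨ι ∘ v, ?_⟩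
      rw [Set.range_comp, ← Submodule.map_span, hv, Submodule.map_comap_eq, inf_comm]
      congr 1
      ext x
      constructor
      · rintro ⟨y, rfl⟩
        simp [ι]
      · intro hx
        refine ⟨Fin.tail x, ?_⟩
        have : x 0 = 0 := hx
        change (Fin.cons 0 (Fin.tail x) : Fin (n + 1) → R) = x
        rw [← this, Fin.cons_self_tail]
    · obtain ⟨a, b, hab⟩ := hR (N.map (LinearMap.proj 0 : (Fin (n + 1) → R) →ₗ[R] R))
      exact ⟨![a, b], by rw [hab]; simp [Ideal.span, Set.pair_comm b a]⟩

/-- The number of isomorphism classes of `(ℤ/p²)[G]`-modules, `G` of order `p`, whose socle has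
order at most `p ^ s`. -/
theorem ncard_isoClasses_le (hG : Nat.card G = p) (g : G) (hg : ∀ x, x ∈ Subgroup.zpowers g)
    (s : ℕ)
    (C : Set (Quotient (isIsomorphicSetoid (ModuleCat.{0} (MonoidAlgebra (ZMod (p ^ 2)) G)))))
    (hC : ∀ c ∈ C, ∃ M : ModuleCat.{0} (MonoidAlgebra (ZMod (p ^ 2)) G), c = Quotient.mk _ M ∧
      {m : M | p • m = 0 ∧
        (MonoidAlgebra.single g 1 : MonoidAlgebra (ZMod (p ^ 2)) G) • m = m}.Finite ∧
      {m : M | p • m = 0 ∧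
        (MonoidAlgebra.single g 1 : MonoidAlgebra (ZMod (p ^ 2)) G) • m = m}.ncard ≤ p ^ s) :
    C.Finite ∧ C.ncard ≤ p ^ (p * (2 * s) ^ 2) := by
  let R := MonoidAlgebra (ZMod (p ^ 2)) G
  let cls : (Fin (2 * s) → Fin s → R) →
      Quotient (isIsomorphicSetoid (ModuleCat.{0} (MonoidAlgebra (ZMod (p ^ 2)) G))) := fun v ↦
    Quotient.mk _ (ModuleCat.of R (Submodule.span R (Set.range v)))
  have e : R ≃ (G → ZMod (p ^ 2)) :=
    (Equiv.mk MonoidAlgebra.coeff MonoidAlgebra.ofCoeff (fun _ ↦ rfl) fun _ ↦ rfl).trans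
      Finsupp.equivFunOnFinite
  have hRfin : Finite R := Finite.of_equiv _ e.symm
  have hRcard : Nat.card R = p ^ (2 * p) := by
    rw [Nat.card_congr e, Nat.card_fun, Nat.card_zmod, hG, ← pow_mul]
  have hsub : C ⊆ Set.range cls := fun c hc ↦ by
    obtain ⟨M, rfl, hfin, hcard⟩ := hC c hc
    obtain ⟨f, hf⟩ := exists_injective_pi hG g s hfin hcard
    obtain ⟨v, hv⟩ := exists_span_range_eq (exists_ideal_eq_span_pair g hg) s (LinearMap.range f)
    refine ⟨v, Quotient.sound ⟨?_⟩⟩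
    exact ((LinearEquiv.ofEq _ _ hv).trans (LinearEquiv.ofInjective f hf).symm).toModuleIso
  refine ⟨(Set.finite_range cls).subset hsub, ?_⟩
  calc C.ncard ≤ (Set.range cls).ncard := Set.ncard_le_ncard hsub (Set.finite_range cls)
    _ = Nat.card (Set.range cls) := rfl
    _ ≤ Nat.card (Fin (2 * s) → Fin s → R) := Finite.card_range_le cls
    -- `|R| = p^(2p)`, raised to the number `s · 2s` of entries.
    _ = p ^ (p * (2 * s) ^ 2) := by
      rw [Nat.card_fun, Nat.card_fun, hRcard, Nat.card_fin, Nat.card_fin, ← pow_mul, ← pow_mul]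
      congr 1
      ring

end Counting

end GaloisUnits

end

noncomputable section

namespace GaloisUnits

/-! ### Indices of kernels and images of commuting operators -/

section Index

/-- On the finite group `X / J`, the endomorphism induced by `f` has kernel and cokernel of the same
order. Here and below a nonzero `relIndex` encodes finiteness. -/
theorem relIndex_sup_map_eq {A : Type} [AddCommGroup A] (f : A →+ A) {J X : AddSubgroup A}
    (hJX : J ≤ X) (hX : X.map f ≤ X) (hJ : J.map f ≤ J) (h0 : J.relIndex X ≠ 0) :
    (J ⊔ X.map f).relIndex X = J.relIndex (X ⊓ J.comap f) := by
  have h1 := AddSubgroup.relIndex_mul_relIndex J (J ⊔ X.map f) X le_sup_left (sup_le hJX hX)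
  have h2 := AddSubgroup.relIndex_mul_relIndex J (X ⊓ J.comap f) X
    (le_inf hJX (AddSubgroup.map_le_iff_le_comap.1 hJ)) inf_le_left
  rw [AddSubgroup.relIndex_sup_left, ← AddSubgroup.relIndex_comap] at h1
  rw [AddSubgroup.inf_relIndex_left] at h2
  rw [← h2, mul_comm] at h1
  refine Nat.eq_of_mul_eq_mul_right (Nat.pos_of_ne_zero fun h ↦ h0 ?_) h1
  rw [← h2, h, mul_zero]

/-- `X / J` surjects onto `f(X) / f(J)`. -/
theorem relIndex_map_le {A B : Type} [AddCommGroup A] [AddCommGroup B] (f : A →+ B)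
    (J X : AddSubgroup A) (h0 : J.relIndex X ≠ 0) :
    (J.map f).relIndex (X.map f) ≤ J.relIndex X ∧ (J.map f).relIndex (X.map f) ≠ 0 := by
  rw [AddSubgroup.relIndex_map_map]
  have h1 : (J ⊔ f.ker).relIndex (X ⊔ f.ker) = (J ⊔ f.ker).relIndex X := by
    have : (J ⊔ f.ker) ⊔ X = (J ⊔ f.ker) ⊔ (X ⊔ f.ker) :=
      le_antisymm (sup_le le_sup_left (le_sup_of_le_right le_sup_left))
        (sup_le le_sup_left (sup_le le_sup_right (le_sup_of_le_left le_sup_right)))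
    rw [← AddSubgroup.relIndex_sup_left (K := J ⊔ f.ker) (H := X), this,
      AddSubgroup.relIndex_sup_left]
  rw [h1]
  exact ⟨AddSubgroup.relIndex_le_of_le_left le_sup_left h0,
    fun h ↦ h0 (AddSubgroup.relIndex_eq_zero_of_le_left le_sup_left h)⟩

variable {Λ A : Type} [CommRing Λ] [AddCommGroup A] [Module Λ A]

variable (A) in
/-- Multiplication by a ring element, as an additive endomorphism. -/
def mulBy (x : Λ) : A →+ A := DistribSMul.toAddMonoidHom A x

@[simp] theorem mulBy_apply (x : Λ) (a : A) : mulBy A x a = x • a := rfl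

theorem mem_ker_mulBy {x : Λ} {a : A} : a ∈ (mulBy A x).ker ↔ x • a = 0 := Iff.rfl

theorem map_mulBy_map (x y : Λ) (H : AddSubgroup A) :
    (H.map (mulBy A x)).map (mulBy A y) = (H.map (mulBy A y)).map (mulBy A x) := by
  rw [AddSubgroup.map_map, AddSubgroup.map_map]
  congr 1
  ext a
  exact smul_comm _ _ _

theorem ker_inf_range_mulBy (x y : Λ) :
    (mulBy A x).ker ⊓ (mulBy A y).range = (mulBy A (x * y)).ker.map (mulBy A y) := by
  ext a
  simp only [AddSubgroup.mem_inf, mem_ker_mulBy, AddMonoidHom.mem_range, AddSubgroup.mem_map,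
    mulBy_apply]
  constructor
  · rintro ⟨h, b, rfl⟩
    exact ⟨b, by rw [mul_smul, h], rfl⟩
  · rintro ⟨b, hb, rfl⟩
    exact ⟨by rw [← mul_smul, hb], b, rfl⟩

/-- The bound for the socle of `H¹(S, A)`, in terms of `H¹(Γ, A)` and `Ĥ⁰(Γ/S, A^S)`. Here `x`
stands for `σ - 1`, `T` and `S` for the norms of `Γ/S` and of the subgroup. -/
theorem relIndex_socle_le (x T S : Λ) (p : ℕ) (h0 : x * T * S = 0)
    (hJ : (mulBy A x).range.relIndex (mulBy A (T * S)).ker ≠ 0)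
    (hD : ((mulBy A (x * T)).ker.map (mulBy A T)).relIndex (mulBy A x).ker ≠ 0) :
    (mulBy A (x * T)).range.relIndex ((mulBy A S).ker ⊓ (mulBy A (x * T)).range.comap (mulBy A x) ⊓
        (mulBy A (x * T)).range.comap (mulBy A (p : Λ))) ≤
      ((mulBy A (x * T)).ker.map (mulBy A T)).relIndex (mulBy A x).ker *
        ((mulBy A x).range ⊔ (mulBy A (T * S)).ker.map (mulBy A (p : Λ))).relIndex
          (mulBy A (T * S)).ker ∧
    (mulBy A (x * T)).range.relIndex ((mulBy A S).ker ⊓ (mulBy A (x * T)).range.comap (mulBy A x) ⊓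
        (mulBy A (x * T)).range.comap (mulBy A (p : Λ))) ≠ 0 := by
  set Soc := (mulBy A S).ker ⊓ (mulBy A (x * T)).range.comap (mulBy A x) ⊓
        (mulBy A (x * T)).range.comap (mulBy A (p : Λ)) with hSoc
  have hmem : ∀ a, a ∈ Soc ↔ S • a = 0 ∧ (∃ b, (x * T) • b = x • a) ∧
      ∃ b, (x * T) • b = (p : Λ) • a := fun a ↦ by
    rw [hSoc, AddSubgroup.mem_inf, AddSubgroup.mem_inf]
    exact and_assoc
  set X := (mulBy A (T * S)).ker with hX
  have hIle : (mulBy A (x * T)).range ≤ Soc ⊓ (mulBy A T).range := by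
    rintro _ ⟨b, rfl⟩
    refine ⟨(hmem _).2 ⟨?_, ⟨x • b, ?_⟩, (p : Λ) • b, ?_⟩, x • b, ?_⟩
    · rw [mulBy_apply, ← mul_smul, mul_comm, h0, zero_smul]
    · rw [mulBy_apply, smul_comm]
    · rw [mulBy_apply, smul_comm]
    · rw [mulBy_apply, mulBy_apply, ← mul_smul, mul_comm]
  have hI : (mulBy A (x * T)).range = (mulBy A x).range.map (mulBy A T) := by
    rw [AddMonoidHom.range_eq_map, AddMonoidHom.range_eq_map, AddSubgroup.map_map]
    congr 1
    ext a
    simp [← mul_smul, mul_comm]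
  have hJX : (mulBy A x).range ≤ X := by
    rintro _ ⟨b, rfl⟩
    change (T * S) • x • b = 0
    rw [← mul_smul, mul_comm, ← mul_assoc, h0, zero_smul]
  have hpX : X.map (mulBy A (p : Λ)) ≤ X := by
    rintro _ ⟨b, hb, rfl⟩
    change (T * S) • (p : Λ) • b = 0
    rw [smul_comm, show (T * S) • b = 0 from hb, smul_zero]
  -- Since `ker x ∩ TA = T ker(xT)`, the quotient `(ker x + TA) / TA` is `Ĥ⁰(Γ/S, A^S)`.
  have hDval : (mulBy A T).range.relIndex ((mulBy A x).ker ⊔ (mulBy A T).range) =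
      ((mulBy A (x * T)).ker.map (mulBy A T)).relIndex (mulBy A x).ker := by
    rw [AddSubgroup.relIndex_sup_right, ← ker_inf_range_mulBy, AddSubgroup.inf_relIndex_left]
  -- If `xa = xTb` then `a - Tb` is killed by `x`; so `Soc / (Soc ∩ TA)` embeds in that `Ĥ⁰`.
  have hSocle : Soc ≤ (mulBy A x).ker ⊔ (mulBy A T).range := by
    intro a ha
    obtain ⟨-, ⟨b, hb⟩, -⟩ := (hmem a).1 ha
    rw [← sub_add_cancel a (T • b)]
    refine AddSubgroup.add_mem_sup ?_ ⟨b, rfl⟩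
    rw [mem_ker_mulBy, smul_sub, ← mul_smul, hb, sub_self]
  have h2 : (Soc ⊓ (mulBy A T).range).relIndex Soc ≤
      ((mulBy A (x * T)).ker.map (mulBy A T)).relIndex (mulBy A x).ker := by
    rw [AddSubgroup.inf_relIndex_left, ← hDval]
    exact AddSubgroup.relIndex_le_of_le_right hSocle (hDval ▸ hD)
  have h2' : (Soc ⊓ (mulBy A T).range).relIndex Soc ≠ 0 := by
    rw [AddSubgroup.inf_relIndex_left]
    exact fun h ↦ hD (hDval ▸ AddSubgroup.relIndex_eq_zero_of_le_right hSocle h)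
  obtain ⟨-, hne⟩ := relIndex_map_le (mulBy A T) _ _ hJ
  have hmapJ : ((mulBy A x).range.map (mulBy A T)).map (mulBy A (p : Λ)) ≤
      (mulBy A x).range.map (mulBy A T) := by
    rw [map_mulBy_map]
    refine AddSubgroup.map_mono ?_
    rintro _ ⟨_, ⟨b, rfl⟩, rfl⟩
    exact ⟨(p : Λ) • b, smul_comm _ _ _⟩
  -- The other layer `(Soc ∩ TA) / xTA` lies in the `p`-torsion of `T ker(TS) / TxA`. That torsion
  -- has the order of the quotient by `p`, which is itself a quotient of `H¹(Γ, A)/p`.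
  have h3 := relIndex_sup_map_eq (mulBy A (p : Λ)) (AddSubgroup.map_mono hJX)
    (by rw [map_mulBy_map]; exact AddSubgroup.map_mono hpX) hmapJ hne
  have hsub : Soc ⊓ (mulBy A T).range ≤ X.map (mulBy A T) ⊓
      ((mulBy A x).range.map (mulBy A T)).comap (mulBy A (p : Λ)) := by
    rintro _ ⟨ha, b, rfl⟩
    obtain ⟨h4, -, h5⟩ := (hmem _).1 ha
    refine ⟨⟨b, ?_, rfl⟩, ?_⟩
    · change (T * S) • b = 0
      rw [mul_comm, mul_smul]
      exact h4
    · rw [← hI]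
      exact h5
  have hne2 : (mulBy A (x * T)).range.relIndex (X.map (mulBy A T) ⊓
      ((mulBy A x).range.map (mulBy A T)).comap (mulBy A (p : Λ))) ≠ 0 := by
    rw [hI]
    exact fun h ↦ hne (AddSubgroup.relIndex_eq_zero_of_le_right inf_le_left h)
  have h6 := AddSubgroup.relIndex_le_of_le_right hsub hne2
  have hne3 : (mulBy A (x * T)).range.relIndex (Soc ⊓ (mulBy A T).range) ≠ 0 :=
    fun h ↦ hne2 (AddSubgroup.relIndex_eq_zero_of_le_right hsub h)
  rw [hI, ← h3, map_mulBy_map, ← AddSubgroup.map_sup, ← hI] at h6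
  have hne4 : ((mulBy A x).range ⊔ X.map (mulBy A (p : Λ))).relIndex X ≠ 0 :=
    fun h ↦ hJ (AddSubgroup.relIndex_eq_zero_of_le_left le_sup_left h)
  have h7 := h6.trans (relIndex_map_le (mulBy A T) _ _ hne4).1
  rw [← AddSubgroup.relIndex_mul_relIndex _ _ _ hIle inf_le_left]
  exact ⟨(mul_comm _ _).trans_le (Nat.mul_le_mul h2 h7), mul_ne_zero hne3 h2'⟩

/-- Inflation: `ker T ∩ xA = x ker(xT)`, so `H¹(Γ/S, A^S) = ker T / x ker(xT)` embeds in `ker(TS) /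
xA = H¹(Γ, A)`. As `T = p + xu`, it lands in the `p`-torsion, which has the order of the quotient by
`p`. -/
theorem relIndex_map_ker_le (x T S u : Λ) (p : ℕ) (h0 : x * T * S = 0) (hT : T = p + x * u)
    (hJ : (mulBy A x).range.relIndex (mulBy A (T * S)).ker ≠ 0) :
    ((mulBy A (x * T)).ker.map (mulBy A x)).relIndex (mulBy A T).ker ≤
      ((mulBy A x).range ⊔ (mulBy A (T * S)).ker.map (mulBy A (p : Λ))).relIndex
        (mulBy A (T * S)).ker := by
  set X := (mulBy A (T * S)).ker with hX
  have hJX : (mulBy A x).range ≤ X := by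
    rintro _ ⟨b, rfl⟩
    change (T * S) • x • b = 0
    rw [← mul_smul, mul_comm, ← mul_assoc, h0, zero_smul]
  have hpX : X.map (mulBy A (p : Λ)) ≤ X := by
    rintro _ ⟨b, hb, rfl⟩
    change (T * S) • (p : Λ) • b = 0
    rw [smul_comm, show (T * S) • b = 0 from hb, smul_zero]
  have hpJ : (mulBy A x).range.map (mulBy A (p : Λ)) ≤ (mulBy A x).range := by
    rintro _ ⟨_, ⟨b, rfl⟩, rfl⟩
    exact ⟨(p : Λ) • b, smul_comm _ _ _⟩
  rw [relIndex_sup_map_eq _ hJX hpX hpJ hJ, mul_comm x, ← ker_inf_range_mulBy,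
    AddSubgroup.inf_relIndex_left]
  refine AddSubgroup.relIndex_le_of_le_right (fun a ha ↦ ⟨?_, ?_⟩)
    fun h ↦ hJ (AddSubgroup.relIndex_eq_zero_of_le_right inf_le_left h)
  · change (T * S) • a = 0
    rw [mul_comm, mul_smul, mem_ker_mulBy.1 ha, smul_zero]
  · refine ⟨-(u • a), ?_⟩
    have h1 := mem_ker_mulBy.1 ha
    rw [hT, add_smul] at h1
    rw [mulBy_apply, mulBy_apply, smul_neg, ← mul_smul]
    exact (eq_neg_of_add_eq_zero_left h1).symm

/-- Each layer `x^i B / x^(i+1) B` is a quotient of `B / xB`. -/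
theorem relIndex_map_pow_le (x : Λ) (B : AddSubgroup A) (hB : B.map (mulBy A x) ≤ B)
    (h0 : (B.map (mulBy A x)).relIndex B ≠ 0) (n : ℕ) :
    (B.map (mulBy A (x ^ n))).relIndex B ≤ (B.map (mulBy A x)).relIndex B ^ n ∧
      (B.map (mulBy A (x ^ n))).relIndex B ≠ 0 := by
  induction n with
  | zero =>
    have : B.map (mulBy A (x ^ 0)) = B := by
      ext a
      simp
    rw [this]
    simp
  | succ n ih =>
    have h1 : B.map (mulBy A (x ^ (n + 1))) = (B.map (mulBy A x)).map (mulBy A (x ^ n)) := by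
      rw [AddSubgroup.map_map]
      congr 1
      ext a
      simp [pow_succ, mul_smul]
    have h2 : B.map (mulBy A (x ^ n)) ≤ B := by
      clear ih h1
      induction n with
      | zero => rintro _ ⟨b, hb, rfl⟩; simpa using hb
      | succ n ih =>
        rintro _ ⟨b, hb, rfl⟩
        rw [mulBy_apply, pow_succ', mul_smul]
        exact hB ⟨_, ih ⟨b, hb, rfl⟩, rfl⟩
    obtain ⟨h3, h4⟩ := relIndex_map_le (mulBy A (x ^ n)) _ _ h0
    rw [h1, ← AddSubgroup.relIndex_mul_relIndex _ _ _ (AddSubgroup.map_mono hB) h2, pow_succ']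
    exact ⟨Nat.mul_le_mul h3 ih.1, mul_ne_zero h4 ih.2⟩

end Index

/-! ### The Herbrand quotient of a `ℤ_p`-lattice -/

section Herbrand

variable {p : ℕ} [Fact p.Prime]

/-- Reducing coordinates modulo `p` identifies `M / pM` with a power of `𝔽_p`. -/
theorem index_range_nsmul (M : Type) [AddCommGroup M] [Module ℤ_[p] M] [Module.Finite ℤ_[p] M]
    [Module.Free ℤ_[p] M] :
    (nsmulAddMonoidHom p : M →+ M).range.index = p ^ Module.finrank ℤ_[p] M := by
  let b := Module.finBasis ℤ_[p] M
  let f : M →+ (Fin (Module.finrank ℤ_[p] M) → ZMod p) :=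
    (RingHom.pi fun i ↦ (PadicInt.toZMod (p := p)).comp
      (Pi.evalRingHom (fun _ ↦ ℤ_[p]) i)).toAddMonoidHom.comp b.equivFun.toLinearMap.toAddMonoidHom
  have hfapp : ∀ m i, f m i = PadicInt.toZMod (b.equivFun m i) := fun _ _ ↦ rfl
  have hsurj : Function.Surjective f := fun y ↦ by
    choose z hz using fun i ↦ ZMod.ringHom_surjective (PadicInt.toZMod (p := p)) (y i)
    refine ⟨b.equivFun.symm z, ?_⟩
    ext i
    rw [hfapp, LinearEquiv.apply_symm_apply, hz]
  have hker : f.ker = (nsmulAddMonoidHom p : M →+ M).range := by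
    ext m
    constructor
    · intro hm
      have h1 : ∀ i, ∃ c : ℤ_[p], b.equivFun m i = p * c := fun i ↦ by
        have : b.equivFun m i ∈ RingHom.ker (PadicInt.toZMod (p := p)) := by
          rw [RingHom.mem_ker, ← hfapp]
          exact congrFun hm i
        rw [PadicInt.ker_toZMod, PadicInt.maximalIdeal_eq_span_p] at this
        exact Ideal.mem_span_singleton.1 this
      choose c hc using h1
      refine ⟨b.equivFun.symm c, b.equivFun.injective ?_⟩
      ext i
      rw [nsmulAddMonoidHom_apply, map_nsmul, LinearEquiv.apply_symm_apply, Pi.smul_apply, hc,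
        nsmul_eq_mul]
    · rintro ⟨a, rfl⟩
      change f (p • a) = 0
      ext i
      rw [map_nsmul]
      simp
  rw [← hker, AddSubgroup.index_ker, AddMonoidHom.range_eq_top.2 hsurj, AddSubgroup.card_top]
  simp

variable {Λ A : Type} [CommRing Λ] [AddCommGroup A] [Module Λ A] [Algebra ℤ_[p] Λ]
  [Module ℤ_[p] A] [IsScalarTower ℤ_[p] Λ A]

omit [Algebra ℤ_[p] Λ] [IsScalarTower ℤ_[p] Λ A] in
theorem relIndex_map_p [Module.Finite ℤ_[p] A] [Module.Free ℤ_[p] A] (M : Submodule ℤ_[p] A) :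
    (M.toAddSubgroup.map (mulBy A (p : Λ))).relIndex M.toAddSubgroup =
      p ^ Module.finrank ℤ_[p] M := by
  rw [← index_range_nsmul M]
  change AddSubgroup.index _ = _
  congr 1
  ext ⟨a, ha⟩
  simp only [AddSubgroup.mem_addSubgroupOf, AddSubgroup.mem_map, mulBy_apply,
    AddMonoidHom.mem_range, nsmulAddMonoidHom_apply, Nat.cast_smul_eq_nsmul]
  constructor
  · rintro ⟨b, hb, h⟩
    exact ⟨⟨b, hb⟩, Subtype.ext h⟩
  · rintro ⟨⟨b, hb⟩, h⟩
    exact ⟨b, hb, congrArg Subtype.val h⟩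

variable (p A) in
/-- The kernel of multiplication by a ring element, as a `ℤ_p`-submodule. -/
def kerMul (x : Λ) : Submodule ℤ_[p] A := LinearMap.ker (Algebra.lsmul ℤ_[p] ℤ_[p] A x)

theorem mem_kerMul {x : Λ} {a : A} : a ∈ kerMul p A x ↔ x • a = 0 := Iff.rfl

/-- If the rank of `ker (xT)` is at least `p` times the rank of `ker x`, then the order of `Ĥ⁰` is
at most the order of `H¹`. -/
theorem relIndex_tateCohomology_le [Module.Finite ℤ_[p] A] [Module.Free ℤ_[p] A]
    (x T u w : Λ) (hT : T = p + x * u) (hx : x ^ (p - 1) = T + p * w)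
    (hrank : p * Module.finrank ℤ_[p] (kerMul p A x) ≤ Module.finrank ℤ_[p] (kerMul p A (x * T))) :
    ((mulBy A (x * T)).ker.map (mulBy A T)).relIndex (mulBy A x).ker ≤
      ((mulBy A (x * T)).ker.map (mulBy A x)).relIndex (mulBy A T).ker ∧
    ((mulBy A (x * T)).ker.map (mulBy A T)).relIndex (mulBy A x).ker ≠ 0 := by
  have hp : p.Prime := Fact.out
  set a := Module.finrank ℤ_[p] (kerMul p A x) with ha
  set b := Module.finrank ℤ_[p] (kerMul p A T) with hb
  -- Rank-nullity for `T : ker(xT) → ker x`, whose kernel lies in `ker T`.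
  have hab : (p - 1) * a ≤ b := by
    let g : kerMul p A (x * T) →ₗ[ℤ_[p]] kerMul p A x :=
      (Algebra.lsmul ℤ_[p] ℤ_[p] A T).restrict fun y hy ↦ by
        change x • T • y = 0
        rw [← mul_smul]
        exact hy
    have h1 := Submodule.finrank_quotient_add_finrank (LinearMap.ker g)
    rw [g.quotKerEquivRange.finrank_eq] at h1
    have h2 : Module.finrank ℤ_[p] (LinearMap.range g) ≤ a := Submodule.finrank_le _
    have h3 : Module.finrank ℤ_[p] (LinearMap.ker g) ≤ b := by
      let ι : LinearMap.ker g →ₗ[ℤ_[p]] kerMul p A T :=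
        ((kerMul p A (x * T)).subtype ∘ₗ (LinearMap.ker g).subtype).codRestrict _ fun y ↦
          congrArg Subtype.val y.2
      refine LinearMap.finrank_le_finrank_of_injective (f := ι) fun y z hyz ↦ ?_
      have h : (y.1 : A) = z.1 := congrArg (fun t : kerMul p A T ↦ (t : A)) hyz
      exact Subtype.ext (Subtype.ext h)
    have h4 : p * a = (p - 1) * a + a := by
      conv_lhs => rw [← Nat.sub_add_cancel hp.one_le]
      ring
    omega
  set K := (mulBy A (x * T)).ker with hK
  set Kx := (mulBy A x).ker with hKx
  set B := (mulBy A T).ker with hB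
  have hKxK : Kx ≤ K := fun y hy ↦ by
    change (x * T) • y = 0
    rw [mul_comm, mul_smul, mem_ker_mulBy.1 hy, smul_zero]
  have hBK : B ≤ K := fun y hy ↦ by
    change (x * T) • y = 0
    rw [mul_smul, mem_ker_mulBy.1 hy, smul_zero]
  have hTKx : Kx.map (mulBy A T) = Kx.map (mulBy A (p : Λ)) := by
    have h : ∀ y ∈ Kx, T • y = (p : Λ) • y := fun y hy ↦ by
      rw [hT, add_smul, mul_comm x, mul_smul, mem_ker_mulBy.1 hy, smul_zero, add_zero]
    ext z
    constructor
    · rintro ⟨y, hy, rfl⟩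
      exact ⟨y, hy, (h y hy).symm⟩
    · rintro ⟨y, hy, rfl⟩
      exact ⟨y, hy, h y hy⟩
  have hTK : K.map (mulBy A T) ≤ Kx := by
    rintro _ ⟨y, hy, rfl⟩
    change x • T • y = 0
    rw [← mul_smul]
    exact hy
  have hxK : K.map (mulBy A x) ≤ B := by
    rintro _ ⟨y, hy, rfl⟩
    change T • x • y = 0
    rw [← mul_smul, mul_comm]
    exact hy
  have h1 := AddSubgroup.relIndex_mul_relIndex _ _ _
    (AddSubgroup.map_mono (f := mulBy A T) hKxK) hTK
  have h2 := AddSubgroup.relIndex_mul_relIndex _ _ _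
    (AddSubgroup.map_mono (f := mulBy A x) hBK) hxK
  have h3 : (Kx.map (mulBy A T)).relIndex Kx = p ^ a := by
    rw [hTKx]
    exact relIndex_map_p (kerMul p A x)
  have h4 : (B.map (mulBy A (p : Λ))).relIndex B = p ^ b := relIndex_map_p (kerMul p A T)
  have hpB : B.map (mulBy A (p : Λ)) ≤ B.map (mulBy A x) := by
    rintro _ ⟨y, hy, rfl⟩
    refine ⟨-(u • y), B.neg_mem ?_, ?_⟩
    · change T • u • y = 0
      rw [smul_comm, mem_ker_mulBy.1 hy, smul_zero]
    · have h5 := mem_ker_mulBy.1 hy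
      rw [hT, add_smul] at h5
      rw [mulBy_apply, mulBy_apply, smul_neg, ← mul_smul]
      exact (eq_neg_of_add_eq_zero_left h5).symm
  have hxpB : B.map (mulBy A (x ^ (p - 1))) ≤ B.map (mulBy A (p : Λ)) := by
    rintro _ ⟨y, hy, rfl⟩
    refine ⟨w • y, ?_, ?_⟩
    · change T • w • y = 0
      rw [smul_comm, mem_ker_mulBy.1 hy, smul_zero]
    · rw [mulBy_apply, mulBy_apply, hx, add_smul, mem_ker_mulBy.1 hy, zero_add, mul_smul]
  have hpos : ∀ n, p ^ n ≠ 0 := fun n ↦ pow_ne_zero _ hp.ne_zero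
  have hxB0 : (B.map (mulBy A x)).relIndex B ≠ 0 := fun h ↦
    hpos b (h4 ▸ AddSubgroup.relIndex_eq_zero_of_le_left hpB h)
  obtain ⟨h5, h6⟩ := relIndex_map_pow_le x B ((AddSubgroup.map_mono hBK).trans hxK) hxB0 (p - 1)
  -- On `B = ker T`, `x^(p-1) = pw`, so `x^(p-1) B ⊆ pB` and `p^b ≤ [B : xB]^(p-1)`; combine with
  -- `(p-1)a ≤ b`.
  have h7 : p ^ a ≤ (B.map (mulBy A x)).relIndex B := by
    have h8 := (AddSubgroup.relIndex_le_of_le_left hxpB h6).trans h5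
    rw [h4] at h8
    refine (Nat.pow_le_pow_iff_left (Nat.sub_ne_zero_of_lt hp.one_lt)).1 (le_trans ?_ h8)
    rw [← pow_mul, mul_comm]
    exact Nat.pow_le_pow_right hp.pos hab
  -- Both quotients are `K / (ker x + ker T)`. Cancelling this common factor from `[ker x : T ker x]
  -- ≤ [B : xB]` compares `Ĥ⁰` with `H¹`.
  have h8 : (Kx.map (mulBy A T)).relIndex (K.map (mulBy A T)) =
      (B.map (mulBy A x)).relIndex (K.map (mulBy A x)) := by
    rw [AddSubgroup.relIndex_map_map, AddSubgroup.relIndex_map_map, ← hB, ← hKx,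
      sup_eq_left.2 hBK, sup_eq_left.2 hKxK, sup_comm]
  rw [h3, h8] at h1
  rw [← h2, ← h1] at h7
  have hne : (B.map (mulBy A x)).relIndex (K.map (mulBy A x)) ≠ 0 := fun h ↦
    hpos a (by rw [← h1, h, zero_mul])
  exact ⟨Nat.le_of_mul_le_mul_left h7 (Nat.pos_of_ne_zero hne), fun h ↦
    hpos a (by rw [← h1, h, mul_zero])⟩

/-- The bound for the socle of `H¹(S, A)` in terms of `H¹(Γ, A)` alone. -/
theorem relIndex_socle_le_pow [Module.Finite ℤ_[p] A] [Module.Free ℤ_[p] A]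
    (x T S u v w : Λ) (h0 : x * T * S = 0) (hT : T = p + x * u)
    (hS : S = (p : Λ) ^ 2 + x * v) (hx : x ^ (p - 1) = T + p * w)
    (hrank : p * Module.finrank ℤ_[p] (kerMul p A x) ≤ Module.finrank ℤ_[p] (kerMul p A (x * T)))
    (c : ℕ) (hc : ((mulBy A x).range ⊔ (mulBy A (T * S)).ker.map (mulBy A (p : Λ))).relIndex
      (mulBy A (T * S)).ker ≤ p ^ c) :
    (mulBy A (x * T)).range.relIndex ((mulBy A S).ker ⊓ (mulBy A (x * T)).range.comap (mulBy A x) ⊓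
        (mulBy A (x * T)).range.comap (mulBy A (p : Λ))) ≤ p ^ (2 * c) ∧
    (mulBy A (x * T)).range.relIndex ((mulBy A S).ker ⊓ (mulBy A (x * T)).range.comap (mulBy A x) ⊓
        (mulBy A (x * T)).range.comap (mulBy A (p : Λ))) ≠ 0 := by
  -- `TS` is congruent to `p³` modulo `x`, so `p³` kills `ker(TS) / xA`; a lattice modulo `p³` is
  -- finite.
  have hJ : (mulBy A x).range.relIndex (mulBy A (T * S)).ker ≠ 0 := by
    set X := (mulBy A (T * S)).ker with hX
    have hpX : X.map (mulBy A (p : Λ)) ≤ X := by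
      rintro _ ⟨b, hb, rfl⟩
      change (T * S) • (p : Λ) • b = 0
      rw [smul_comm, show (T * S) • b = 0 from hb, smul_zero]
    have h1 : (X.map (mulBy A (p : Λ))).relIndex X ≠ 0 := by
      have : (X.map (mulBy A (p : Λ))).relIndex X = _ := relIndex_map_p (kerMul p A (T * S))
      rw [this]
      exact pow_ne_zero _ (Fact.out : p.Prime).ne_zero
    have h2 := (relIndex_map_pow_le (p : Λ) X hpX h1 3).2
    refine fun h ↦ h2 (AddSubgroup.relIndex_eq_zero_of_le_left ?_ h)
    rintro _ ⟨y, hy, rfl⟩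
    refine ⟨-((p * v + u * S) • y), ?_⟩
    have h3 : (T * S) • y = 0 := hy
    have h4 : T * S = (p : Λ) ^ 3 + x * (p * v + u * S) := by
      rw [hT]
      linear_combination (p : Λ) * hS
    rw [h4, add_smul] at h3
    rw [mulBy_apply, mulBy_apply, smul_neg, ← mul_smul]
    exact (eq_neg_of_add_eq_zero_left h3).symm
  obtain ⟨h1, h2⟩ := relIndex_tateCohomology_le x T u w hT hx hrank
  obtain ⟨h3, h4⟩ := relIndex_socle_le x T S p h0 hJ h2
  refine ⟨h3.trans ?_, h4⟩
  rw [two_mul, pow_add]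
  exact Nat.mul_le_mul ((h1.trans (relIndex_map_ker_le x T S u p h0 hT hJ)).trans hc) hc

end Herbrand

end GaloisUnits

end

noncomputable section

namespace GaloisUnits

/-! ### Cocycles of a cyclic subgroup -/

section Cyclic

variable {k Γ : Type} [CommRing k] [CommGroup Γ]

/-- The element `1 + x + ⋯ + x ^ (n - 1)`. -/
def geom {R : Type} [Semiring R] (x : R) (n : ℕ) : R := ∑ i ∈ Finset.range n, x ^ i

theorem exists_geom_eq {R : Type} [CommRing R] (x : R) (n : ℕ) :
    ∃ u, geom x n = (n : R) + (x - 1) * u := by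
  refine ⟨∑ i ∈ Finset.range n, ∑ j ∈ Finset.range i, x ^ j, ?_⟩
  rw [geom, Finset.mul_sum]
  have : ∀ i, (x - 1) * ∑ j ∈ Finset.range i, x ^ j = x ^ i - 1 := fun i ↦ mul_geom_sum x i
  simp [this]

theorem sub_one_mul_geom {R : Type} [CommRing R] (x : R) (n : ℕ) :
    (x - 1) * geom x n = x ^ n - 1 := mul_geom_sum x n

theorem geom_mul_geom {R : Type} [CommRing R] (x : R) (m n : ℕ) :
    geom x m * geom (x ^ m) n = geom x (m * n) := by
  induction n with
  | zero => simp [geom]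
  | succ n ih =>
    have h1 : geom (x ^ m) (n + 1) = geom (x ^ m) n + x ^ (m * n) := by
      rw [geom, Finset.sum_range_succ, ← pow_mul]
      rfl
    have h2 : geom x (m * n + m) = geom x (m * n) + x ^ (m * n) * geom x m := by
      rw [geom, Finset.sum_range_add, geom, geom, Finset.mul_sum]
      simp_rw [pow_add]
    rw [h1, mul_add, ih, mul_add, mul_one, h2, mul_comm (geom x m)]

/-- In `𝔽_p[X]`, `(X - 1)^p = X^p - 1 = (X - 1)(1 + ⋯ + X^(p-1))`; cancel `X - 1`, lift to `ℤ[X]`,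
and evaluate at `x`. -/
theorem exists_sub_one_pow_pred_eq {R : Type} [CommRing R] (x : R) (p : ℕ) [hp : Fact p.Prime] :
    ∃ w, (x - 1) ^ (p - 1) = geom x p + p * w := by
  suffices h : ∃ w : Polynomial ℤ, (Polynomial.X - 1 : Polynomial ℤ) ^ (p - 1) =
      geom (Polynomial.X : Polynomial ℤ) p + (p : Polynomial ℤ) * w by
    obtain ⟨w, hw⟩ := h
    refine ⟨Polynomial.aeval x w, ?_⟩
    have := congrArg (Polynomial.aeval x) hw
    simpa [geom] using this
  let π := Polynomial.mapRingHom (Int.castRingHom (ZMod p))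
  have h1 : π ((Polynomial.X - 1) ^ (p - 1)) = π (geom (Polynomial.X : Polynomial ℤ) p) := by
    have hX : (Polynomial.X - 1 : Polynomial (ZMod p)) ≠ 0 := Polynomial.X_sub_C_ne_zero 1
    refine mul_left_cancel₀ hX ?_
    have h2 : π (Polynomial.X - 1) = Polynomial.X - 1 := by simp [π]
    conv_lhs => rw [map_pow, h2, ← pow_succ', Nat.sub_add_cancel hp.out.one_le]
    conv_rhs => rw [← h2, ← map_mul, sub_one_mul_geom]
    rw [sub_pow_char]
    simp [π]
  rw [← sub_eq_zero, ← map_sub] at h1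
  obtain ⟨w, hw⟩ : (Polynomial.C (p : ℤ)) ∣ (Polynomial.X - 1) ^ (p - 1) -
      geom (Polynomial.X : Polynomial ℤ) p := by
    rw [Polynomial.C_dvd_iff_dvd_coeff]
    intro i
    rw [← ZMod.intCast_zmod_eq_zero_iff_dvd]
    have := congrArg (fun q ↦ Polynomial.coeff q i) h1
    simpa only [π, Polynomial.coe_mapRingHom, Polynomial.coeff_map, Polynomial.coeff_zero,
      eq_intCast] using this
  exact ⟨w, by rw [← sub_eq_iff_eq_add', hw]; simp⟩

variable (A : Rep.{0} k Γ) (S : Subgroup Γ)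

/-- The element of the group ring attached to an element of the group. -/
def gr (k : Type) [CommRing k] {Γ : Type} [CommGroup Γ] (σ : Γ) : MonoidAlgebra k Γ :=
  MonoidAlgebra.single σ 1

theorem gr_pow (σ : Γ) (n : ℕ) : gr k σ ^ n = gr k (σ ^ n) := by
  simp [gr, MonoidAlgebra.single_pow]

theorem gr_smul {V : Type} [AddCommGroup V] [Module k V] (ρ : Representation k Γ V) (σ : Γ)
    (a : ρ.asModule) : gr k σ • a = ρ.asModuleEquiv.symm (ρ σ (ρ.asModuleEquiv a)) := by
  rw [gr, Representation.single_smul, one_smul]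
  rfl

variable {A S}

/-- The value of a cocycle, as an element of the module over the group ring. -/
def cocycleValue (f : groupCohomology.cocycles₁ (Rep.res S.subtype A)) (s : S) : A.ρ.asModule :=
  A.ρ.asModuleEquiv.symm (f s)

theorem cocycleValue_mul (f : groupCohomology.cocycles₁ (Rep.res S.subtype A)) (s t : S) :
    cocycleValue f (s * t) = gr k (s : Γ) • cocycleValue f t + cocycleValue f s := by
  rw [gr_smul]
  exact (groupCohomology.mem_cocycles₁_iff (f : S → A)).1 f.2 s t

theorem cocycleValue_one (f : groupCohomology.cocycles₁ (Rep.res S.subtype A)) :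
    cocycleValue f 1 = 0 := by
  rw [cocycleValue, groupCohomology.cocycles₁_map_one]
  exact map_zero _

theorem cocycleValue_nsmul (n : ℕ) (f : groupCohomology.cocycles₁ (Rep.res S.subtype A)) (s : S) :
    cocycleValue (n • f) s = n • cocycleValue f s := rfl

theorem cocycleValue_conjCocycle (g : Γ) (f : groupCohomology.cocycles₁ (Rep.res S.subtype A))
    (s : S) : cocycleValue (conjCocycle A S g f) s = gr k g • cocycleValue f s := by
  rw [gr_smul, cocycleValue, conjCocycle_apply]
  have : (MulAut.conjNormal g⁻¹ s : S) = s := by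
    ext
    simp [mul_comm]
  rw [this]
  rfl

theorem H1π_eq_iff_exists (f g : groupCohomology.cocycles₁ (Rep.res S.subtype A)) :
    groupCohomology.H1π (Rep.res S.subtype A) f = groupCohomology.H1π (Rep.res S.subtype A) g ↔
      ∃ b : A.ρ.asModule, ∀ s : S,
        (gr k (s : Γ) - 1) • b = cocycleValue f s - cocycleValue g s := by
  simp_rw [sub_smul, one_smul, gr_smul]
  rw [groupCohomology.H1π_eq_iff]
  exact ⟨fun ⟨b, hb⟩ ↦ ⟨b, fun s ↦ congrFun hb s⟩, fun ⟨b, hb⟩ ↦ ⟨b, funext hb⟩⟩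

theorem cocycleValue_pow (f : groupCohomology.cocycles₁ (Rep.res S.subtype A)) (t : S) (n : ℕ) :
    cocycleValue f (t ^ n) = geom (gr k (t : Γ)) n • cocycleValue f t := by
  induction n with
  | zero => rw [pow_zero, cocycleValue_one]; simp [geom]
  | succ n ih =>
    rw [pow_succ', cocycleValue_mul, ih, ← mul_smul, geom, geom, Finset.sum_range_succ', pow_zero,
      add_smul, one_smul, Finset.mul_sum]
    simp_rw [pow_succ']

/-- A cocycle on a cyclic group is determined by its value at a generator, so being a coboundary can
be tested there. -/
theorem H1π_eq_of_generator (f g : groupCohomology.cocycles₁ (Rep.res S.subtype A)) (t : S)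
    (ht : ∀ s : S, ∃ n : ℕ, t ^ n = s) :
    groupCohomology.H1π (Rep.res S.subtype A) f = groupCohomology.H1π (Rep.res S.subtype A) g ↔
      ∃ b : A.ρ.asModule, (gr k (t : Γ) - 1) • b = cocycleValue f t - cocycleValue g t := by
  rw [H1π_eq_iff_exists]
  refine ⟨fun ⟨b, hb⟩ ↦ ⟨b, hb t⟩, fun ⟨b, hb⟩ ↦ ⟨b, fun s ↦ ?_⟩⟩
  obtain ⟨n, rfl⟩ := ht s
  rw [cocycleValue_pow, cocycleValue_pow, ← smul_sub, ← hb, ← mul_smul, mul_comm,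
    sub_one_mul_geom, gr_pow, Subgroup.coe_pow]

/-- If `σ^n` lies in a subgroup of order `p²`, then `p³ ∣ n p²`, so `p ∣ n`; orders then force `S =
⟨σ^p⟩`. -/
theorem exists_generator_subgroup {p : ℕ} [Fact p.Prime] (hΓ : Nat.card Γ = p ^ 3)
    (hS : Nat.card S = p ^ 2) (σ : Γ) (hσ : ∀ x, x ∈ Subgroup.zpowers σ) :
    ∃ t : S, (t : Γ) = σ ^ p ∧ t ^ (p ^ 2) = 1 ∧ ∀ s : S, ∃ n : ℕ, t ^ n = s := by
  have hp : p.Prime := Fact.out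
  have hfin : Finite Γ := Nat.finite_of_card_ne_zero (hΓ ▸ pow_ne_zero _ hp.ne_zero)
  have hord : orderOf σ = p ^ 3 := by rw [orderOf_eq_card_of_forall_mem_zpowers hσ, hΓ]
  have hle : S ≤ Subgroup.zpowers (σ ^ p) := fun s hs ↦ by
    obtain ⟨n, rfl⟩ := (Submonoid.mem_powers_iff _ _).1 (mem_powers_iff_mem_zpowers.2 (hσ s))
    have h1 : (⟨σ ^ n, hs⟩ : S) ^ (p ^ 2) = 1 := by rw [← hS]; exact pow_card_eq_one'
    have h2 : σ ^ (n * p ^ 2) = 1 := by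
      rw [pow_mul]
      exact congrArg Subtype.val h1
    rw [← orderOf_dvd_iff_pow_eq_one, hord, pow_succ'] at h2
    obtain ⟨m, rfl⟩ := Nat.dvd_of_mul_dvd_mul_right (pow_pos hp.pos 2) h2
    rw [pow_mul]
    exact Subgroup.npow_mem_zpowers _ _
  have hord2 : orderOf (σ ^ p) = p ^ 2 := by
    rw [orderOf_pow, hord, Nat.gcd_eq_right (dvd_pow_self p three_ne_zero), pow_succ,
      Nat.mul_div_cancel _ hp.pos]
  have heq : S = Subgroup.zpowers (σ ^ p) :=
    Subgroup.eq_of_le_of_card_ge hle (by rw [Nat.card_zpowers, hord2, hS])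
  refine ⟨⟨σ ^ p, heq ▸ Subgroup.mem_zpowers _⟩, rfl, ?_, fun s ↦ ?_⟩
  · ext
    rw [← hord2]
    exact pow_orderOf_eq_one _
  · have h1 : (s : Γ) ∈ Subgroup.zpowers (σ ^ p) := hle s.2
    obtain ⟨n, hn⟩ := (Submonoid.mem_powers_iff _ _).1 (mem_powers_iff_mem_zpowers.2 h1)
    exact ⟨n, Subtype.ext hn⟩

/-- The element of `H¹(S, A)` underlying an element of the module `H¹(S, A)`. -/
def toH1 {m : ℕ} [NeZero m] (hS : Nat.card S = m) (x : moduleH1 A S hS) : H1Sub A S := x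

theorem toH1_injective {m : ℕ} [NeZero m] (hS : Nat.card S = m) :
    Function.Injective (toH1 (A := A) hS) := fun _ _ h ↦ h

theorem toH1_single_smul {m : ℕ} [NeZero m] (hS : Nat.card S = m) (σ : Γ) (x : moduleH1 A S hS) :
    toH1 hS ((MonoidAlgebra.single (σ : Γ ⧸ S) 1 : MonoidAlgebra (ZMod m) (Γ ⧸ S)) • x) =
      conjH1 A S σ (toH1 hS x) := by
  let := zmodModuleH1 A S hS
  have h := Representation.single_smul (ρ := zmodRepH1 A S hS) 1 (σ : Γ ⧸ S) x
  rw [one_smul] at h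
  exact h

/-- The socle of `H¹(S, A)` embeds in a subquotient of `A`. -/
theorem ncard_socle_le {p : ℕ} [Fact p.Prime] (hΓ : Nat.card Γ = p ^ 3)
    (hS : Nat.card S = p ^ 2) (σ : Γ) (hσ : ∀ x, x ∈ Subgroup.zpowers σ) (N : ℕ)
    (hN : (mulBy A.ρ.asModule (gr k σ ^ p - 1)).range.relIndex
      ((mulBy A.ρ.asModule (geom (gr k σ ^ p) (p ^ 2))).ker ⊓
        (mulBy A.ρ.asModule (gr k σ ^ p - 1)).range.comap (mulBy A.ρ.asModule (gr k σ - 1)) ⊓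
        (mulBy A.ρ.asModule (gr k σ ^ p - 1)).range.comap
          (mulBy A.ρ.asModule (p : MonoidAlgebra k Γ))) ≤ N ∧
      (mulBy A.ρ.asModule (gr k σ ^ p - 1)).range.relIndex
      ((mulBy A.ρ.asModule (geom (gr k σ ^ p) (p ^ 2))).ker ⊓
        (mulBy A.ρ.asModule (gr k σ ^ p - 1)).range.comap (mulBy A.ρ.asModule (gr k σ - 1)) ⊓
        (mulBy A.ρ.asModule (gr k σ ^ p - 1)).range.comap
          (mulBy A.ρ.asModule (p : MonoidAlgebra k Γ))) ≠ 0) :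
    {m : moduleH1 A S hS | p • m = 0 ∧
      (MonoidAlgebra.single (σ : Γ ⧸ S) 1 : MonoidAlgebra (ZMod (p ^ 2)) (Γ ⧸ S)) • m = m}.Finite ∧
    {m : moduleH1 A S hS | p • m = 0 ∧
      (MonoidAlgebra.single (σ : Γ ⧸ S) 1 : MonoidAlgebra (ZMod (p ^ 2)) (Γ ⧸ S)) • m = m}.ncard
        ≤ N := by
  obtain ⟨t, htσ, htp, ht⟩ := exists_generator_subgroup hΓ hS σ hσ
  set Soc := (mulBy A.ρ.asModule (geom (gr k σ ^ p) (p ^ 2))).ker ⊓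
        (mulBy A.ρ.asModule (gr k σ ^ p - 1)).range.comap (mulBy A.ρ.asModule (gr k σ - 1)) ⊓
        (mulBy A.ρ.asModule (gr k σ ^ p - 1)).range.comap
          (mulBy A.ρ.asModule (p : MonoidAlgebra k Γ)) with hSoc
  set I := (mulBy A.ρ.asModule (gr k σ ^ p - 1)).range with hI
  have hgr : gr k σ ^ p = gr k (t : Γ) := by rw [gr_pow, htσ]
  set V : Set (moduleH1 A S hS) := {m | p • m = 0 ∧
      (MonoidAlgebra.single (σ : Γ ⧸ S) 1 : MonoidAlgebra (ZMod (p ^ 2)) (Γ ⧸ S)) • m = m} with hV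
  have hex : ∀ m : moduleH1 A S hS, ∃ f : groupCohomology.cocycles₁ (Rep.res S.subtype A),
      groupCohomology.H1π (Rep.res S.subtype A) f = toH1 hS m := fun m ↦
    groupCohomology.H1_induction_on (C := fun x : H1Sub A S ↦ ∃ f,
      groupCohomology.H1π (Rep.res S.subtype A) f = x) _ fun x ↦ ⟨x, rfl⟩
  choose F hF using hex
  -- Evaluation at `t` sends a cocycle into the kernel of the norm, and the two socle conditions
  -- become membership of `(σ - 1) f(t)` and `p f(t)` in `(t - 1)A`.
  have hmem : ∀ m ∈ V, cocycleValue (F m) t ∈ Soc := by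
    rintro m ⟨hm1, hm2⟩
    refine ⟨⟨?_, ?_⟩, ?_⟩
    · change geom (gr k σ ^ p) (p ^ 2) • cocycleValue (F m) t = 0
      rw [hgr, ← cocycleValue_pow, htp, cocycleValue_one]
    · have h1 := congrArg (toH1 hS) hm2
      rw [toH1_single_smul, ← hF, conjH1_π, H1π_eq_of_generator _ _ t ht] at h1
      obtain ⟨b, hb⟩ := h1
      refine ⟨b, ?_⟩
      rw [mulBy_apply, hgr, hb, mulBy_apply, sub_smul, one_smul, cocycleValue_conjCocycle]
    · have h1 := congrArg (toH1 hS) hm1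
      have h2 : groupCohomology.H1π (Rep.res S.subtype A) (p • F m) =
          groupCohomology.H1π (Rep.res S.subtype A) 0 := by
        rw [map_nsmul, map_zero, hF]
        exact h1
      obtain ⟨b, hb⟩ := (H1π_eq_of_generator _ _ t ht).1 h2
      refine ⟨b, ?_⟩
      rw [mulBy_apply, hgr, hb, mulBy_apply, Nat.cast_smul_eq_nsmul, cocycleValue_nsmul]
      exact sub_zero _
  let e : V → (Soc ⧸ I.addSubgroupOf Soc) := fun m ↦ QuotientAddGroup.mk ⟨_, hmem m.1 m.2⟩
  have he : Function.Injective e := by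
    intro m n hmn
    have h1 := QuotientAddGroup.eq.1 hmn
    rw [AddSubgroup.mem_addSubgroupOf] at h1
    obtain ⟨b, hb⟩ := h1
    apply Subtype.ext
    apply toH1_injective hS
    rw [← hF, ← hF, H1π_eq_of_generator _ _ t ht]
    refine ⟨-b, ?_⟩
    rw [mulBy_apply, hgr] at hb
    rw [smul_neg, hb]
    change -(-(cocycleValue (F m.1) t) + cocycleValue (F n.1) t) = _
    rw [neg_add_rev, neg_neg, ← sub_eq_neg_add]
  have hfin : Finite (Soc ⧸ I.addSubgroupOf Soc) := AddSubgroup.index_ne_zero_iff_finite.1 hN.2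
  have hVfin : Finite V := Finite.of_injective e he
  exact ⟨hVfin, (Nat.card_le_card_of_injective e he).trans hN.1⟩

end Cyclic

end GaloisUnits

end

noncomputable section

namespace GaloisUnits

/-! ### From a `ℤ`-lattice to its `p`-adic completion -/

section BaseChange

variable {p : ℕ} [Fact p.Prime] {Γ : Type} [CommGroup Γ] {E : Type} [AddCommGroup E]

variable (ρ : Representation ℤ_[p] Γ (ℤ_[p] ⊗[ℤ] E)) (σ : Γ) (g : Module.End ℤ E)

/-- The image of `e` in `ℤ_p ⊗ E`. -/
def ofLattice : E →+ ρ.asModule :=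
  ρ.asModuleEquiv.symm.toLinearMap.toAddMonoidHom.comp
    (TensorProduct.mk ℤ ℤ_[p] E 1).toAddMonoidHom

variable {ρ σ g}

/-- Each operator needed is an integer polynomial in `σ`, so it comes from the lattice `E`. -/
theorem aeval_gr_smul (hg : ρ σ = g.baseChange ℤ_[p]) (q : Polynomial ℤ) (a : ρ.asModule) :
    Polynomial.aeval (gr ℤ_[p] σ) q • a =
      ρ.asModuleEquiv.symm ((Polynomial.aeval g q).baseChange ℤ_[p] (ρ.asModuleEquiv a)) := by
  have h1 : ρ.asAlgebraHom (Polynomial.aeval (gr ℤ_[p] σ) q) =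
      (Polynomial.aeval g q).baseChange ℤ_[p] := by
    have h2 : ρ.asAlgebraHom (gr ℤ_[p] σ) = Module.End.baseChangeHom ℤ ℤ_[p] E g := by
      rw [gr, Representation.asAlgebraHom_single_one, hg]
      rfl
    have h3 := Polynomial.aeval_algHom_apply (ρ.asAlgebraHom.restrictScalars ℤ) (gr ℤ_[p] σ) q
    have h4 := Polynomial.aeval_algHom_apply (Module.End.baseChangeHom ℤ ℤ_[p] E) g q
    refine h3.symm.trans (Eq.trans ?_ h4)
    congr 2
  rw [← h1]
  rfl

/-- Kernels commute with the flat base change `ℤ → ℤ_p`. -/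
theorem finrank_kerMul_aeval [Module.Finite ℤ E] [Module.Free ℤ E]
    (hg : ρ σ = g.baseChange ℤ_[p]) (q : Polynomial ℤ) :
    Module.finrank ℤ_[p] (kerMul p ρ.asModule (Polynomial.aeval (gr ℤ_[p] σ) q)) =
      Module.finrank ℤ (LinearMap.ker (Polynomial.aeval g q)) := by
  have e1 := LinearMap.tensorKerEquiv ℤ_[p] ℤ_[p] (Polynomial.aeval g q)
  have e2 : LinearMap.ker (TensorProduct.AlgebraTensorModule.lTensor ℤ_[p] ℤ_[p]
      (Polynomial.aeval g q)) ≃ₗ[ℤ_[p]]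
      kerMul p ρ.asModule (Polynomial.aeval (gr ℤ_[p] σ) q) :=
    { toFun := fun x ↦ ⟨ρ.asModuleEquiv.symm x.1, by
        rw [mem_kerMul, aeval_gr_smul hg]
        exact x.2⟩
      invFun := fun x ↦ ⟨ρ.asModuleEquiv x.1, by
        have h := mem_kerMul.1 x.2
        rw [aeval_gr_smul hg] at h
        exact h⟩
      map_add' := fun _ _ ↦ rfl
      map_smul' := fun _ _ ↦ rfl
      left_inv := fun _ ↦ rfl
      right_inv := fun _ ↦ rfl }
  rw [← e2.finrank_eq, ← e1.finrank_eq, Module.finrank_baseChange]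

/-- By flatness the kernel is `ℤ_p ⊗ ker`, and every `p`-adic integer is a natural number modulo
`p`. -/
theorem exists_ofLattice_add (hg : ρ σ = g.baseChange ℤ_[p]) (q : Polynomial ℤ)
    (a : ρ.asModule) (ha : a ∈ (mulBy ρ.asModule (Polynomial.aeval (gr ℤ_[p] σ) q)).ker) :
    ∃ e ∈ LinearMap.ker (Polynomial.aeval g q),
      ∃ b ∈ (mulBy ρ.asModule (Polynomial.aeval (gr ℤ_[p] σ) q)).ker,
        a = ofLattice ρ e + (p : MonoidAlgebra ℤ_[p] Γ) • b := by
  have h1 : ρ.asModuleEquiv a ∈ LinearMap.ker (TensorProduct.AlgebraTensorModule.lTensor ℤ_[p]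
      ℤ_[p] (Polynomial.aeval g q)) := by
    have h := mem_ker_mulBy.1 ha
    rw [aeval_gr_smul hg] at h
    exact h
  rw [Module.Flat.ker_lTensor_eq] at h1
  obtain ⟨y, hy⟩ := h1
  obtain rfl : ρ.asModuleEquiv.symm (TensorProduct.AlgebraTensorModule.lTensor ℤ_[p] ℤ_[p]
      (LinearMap.ker (Polynomial.aeval g q)).subtype y) = a := by rw [hy]; rfl
  clear hy ha
  induction y with
  | zero => exact ⟨0, zero_mem _, 0, zero_mem _, by simp⟩
  | add y z hy hz =>
    obtain ⟨e, he, b, hb, h1⟩ := hy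
    obtain ⟨e', he', b', hb', h2⟩ := hz
    refine ⟨e + e', add_mem he he', b + b', add_mem hb hb', ?_⟩
    rw [map_add, map_add, map_add, smul_add, h1, h2]
    abel
  | tmul z k =>
    obtain ⟨n, -, hn⟩ := PadicInt.exists_mem_range z
    rw [PadicInt.maximalIdeal_eq_span_p] at hn
    obtain ⟨w, hw⟩ := Ideal.mem_span_singleton.1 hn
    refine ⟨n • k.1, nsmul_mem k.2 n, ρ.asModuleEquiv.symm (w ⊗ₜ k.1), ?_, ?_⟩
    · rw [mem_ker_mulBy, aeval_gr_smul hg, LinearEquiv.apply_symm_apply, LinearMap.baseChange_tmul,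
        LinearMap.mem_ker.1 k.2, TensorProduct.tmul_zero, map_zero]
    · rw [Nat.cast_smul_eq_nsmul, ← map_nsmul]
      change ρ.asModuleEquiv.symm (z ⊗ₜ k.1) = ρ.asModuleEquiv.symm ((1 : ℤ_[p]) ⊗ₜ (n • k.1)) + _
      rw [← map_add]
      congr 1
      rw [← TensorProduct.smul_tmul, TensorProduct.smul_tmul', ← TensorProduct.add_tmul,
        nsmul_eq_mul, mul_one, nsmul_eq_mul, ← hw]
      congr 1
      ring

/-- Modulo `p`, every class in the `p`-adic kernel comes from the lattice kernel, so the index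
cannot grow. -/
theorem relIndex_baseChange_le (hg : ρ σ = g.baseChange ℤ_[p]) (q₁ q₂ : Polynomial ℤ) (N : ℕ)
    (h : ((LinearMap.range (Polynomial.aeval g q₂)).toAddSubgroup ⊔
      (LinearMap.ker (Polynomial.aeval g q₁)).toAddSubgroup.map (nsmulAddMonoidHom p)).relIndex
        (LinearMap.ker (Polynomial.aeval g q₁)).toAddSubgroup ≤ N ∧
      ((LinearMap.range (Polynomial.aeval g q₂)).toAddSubgroup ⊔
      (LinearMap.ker (Polynomial.aeval g q₁)).toAddSubgroup.map (nsmulAddMonoidHom p)).relIndex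
        (LinearMap.ker (Polynomial.aeval g q₁)).toAddSubgroup ≠ 0) :
    ((mulBy ρ.asModule (Polynomial.aeval (gr ℤ_[p] σ) q₂)).range ⊔
      (mulBy ρ.asModule (Polynomial.aeval (gr ℤ_[p] σ) q₁)).ker.map
        (mulBy ρ.asModule (p : MonoidAlgebra ℤ_[p] Γ))).relIndex
      (mulBy ρ.asModule (Polynomial.aeval (gr ℤ_[p] σ) q₁)).ker ≤ N := by
  set X := (mulBy ρ.asModule (Polynomial.aeval (gr ℤ_[p] σ) q₁)).ker with hX
  set J := (mulBy ρ.asModule (Polynomial.aeval (gr ℤ_[p] σ) q₂)).range with hJ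
  set X' := (LinearMap.ker (Polynomial.aeval g q₁)).toAddSubgroup with hX'
  set J' := (LinearMap.range (Polynomial.aeval g q₂)).toAddSubgroup with hJ'
  have hι : ∀ (q : Polynomial ℤ) (e : E), Polynomial.aeval (gr ℤ_[p] σ) q • ofLattice ρ e =
      ofLattice ρ (Polynomial.aeval g q e) := fun q e ↦ by
    rw [aeval_gr_smul hg]
    rfl
  have h1 : X'.map (ofLattice ρ) ≤ X := by
    rintro _ ⟨e, he, rfl⟩
    rw [mem_ker_mulBy, hι, LinearMap.mem_ker.1 he, map_zero]
  have h2 : X ≤ X'.map (ofLattice ρ) ⊔ (J ⊔ X.map (mulBy ρ.asModule (p : MonoidAlgebra ℤ_[p] Γ))) :=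
    fun a ha ↦ by
    obtain ⟨e, he, b, hb, rfl⟩ := exists_ofLattice_add hg q₁ a ha
    exact AddSubgroup.add_mem_sup ⟨e, he, rfl⟩ (AddSubgroup.mem_sup_right ⟨b, hb, rfl⟩)
  have h3 : J' ⊔ X'.map (nsmulAddMonoidHom p) ≤
      (J ⊔ X.map (mulBy ρ.asModule (p : MonoidAlgebra ℤ_[p] Γ))).comap (ofLattice ρ) := by
    refine sup_le ?_ ?_
    · rintro _ ⟨e, rfl⟩
      exact AddSubgroup.mem_sup_left ⟨ofLattice ρ e, hι q₂ e⟩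
    · rintro _ ⟨e, he, rfl⟩
      refine AddSubgroup.mem_sup_right ⟨ofLattice ρ e, h1 ⟨e, he, rfl⟩, ?_⟩
      rw [mulBy_apply, Nat.cast_smul_eq_nsmul, nsmulAddMonoidHom_apply, map_nsmul]
  have h4 := AddSubgroup.relIndex_le_of_le_left h3 h.2
  have h5 : ((J ⊔ X.map (mulBy ρ.asModule (p : MonoidAlgebra ℤ_[p] Γ))).comap
      (ofLattice ρ)).relIndex X' ≠ 0 :=
    fun h0 ↦ h.2 (AddSubgroup.relIndex_eq_zero_of_le_left h3 h0)
  rw [AddSubgroup.relIndex_comap, ← AddSubgroup.relIndex_sup_right] at h4 h5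
  exact ((AddSubgroup.relIndex_le_of_le_right h2 h5).trans h4).trans h.1

end BaseChange

end GaloisUnits

end

noncomputable section

namespace GaloisUnits

/-! ### Valuations of elements and fractional ideals -/

section Dedekind

open IsDedekindDomain nonZeroDivisors

variable {R K : Type} [CommRing R] [IsDedekindDomain R] [Field K] [Algebra R K]
  [IsFractionRing R K]

/-- The sign arises because the multiplicative valuation has exponent `-ord_v`. -/
theorem count_spanSingleton (v : HeightOneSpectrum R) (x : Kˣ) :
    FractionalIdeal.count K v (FractionalIdeal.spanSingleton R⁰ (x : K)) =
      -(v.valuationOfNeZero x).toAdd := by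
  classical
  obtain ⟨n, d, hx⟩ := IsLocalization.exists_mk'_eq R⁰ (x : K)
  have hn : n ≠ 0 := fun h ↦ x.ne_zero (by rw [← hx, h, IsLocalization.mk'_zero])
  have hd : (d : R) ≠ 0 := nonZeroDivisors.coe_ne_zero d
  have h1 : FractionalIdeal.spanSingleton R⁰ (x : K) =
      FractionalIdeal.spanSingleton R⁰ (algebraMap R K d)⁻¹ * (Ideal.span {n} : Ideal R) := by
    rw [FractionalIdeal.coeIdeal_span_singleton, FractionalIdeal.spanSingleton_mul_spanSingleton,
      ← hx, IsFractionRing.mk'_eq_div, div_eq_inv_mul]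
  rw [FractionalIdeal.count_well_defined K v
    (FractionalIdeal.spanSingleton_ne_zero_iff.2 x.ne_zero) h1]
  have h2 : ((v.valuationOfNeZero x : Multiplicative ℤ) : WithZero (Multiplicative ℤ)) =
      WithZero.exp (-((Associates.mk v.asIdeal).count (Associates.mk (Ideal.span {n})).factors : ℤ)
        + ((Associates.mk v.asIdeal).count
          (Associates.mk (Ideal.span {(d : R)})).factors : ℤ)) := by
    rw [HeightOneSpectrum.valuationOfNeZero_eq, ← hx, HeightOneSpectrum.valuation_of_mk',
      v.intValuation_if_neg hn, v.intValuation_if_neg hd, WithZero.exp_add, WithZero.exp_neg,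
      WithZero.exp_neg, div_inv_eq_mul]
  have h3 := WithZero.coe_injective h2
  rw [h3, toAdd_ofAdd]
  ring

theorem fractionalIdeal_ext {I J : FractionalIdeal R⁰ K} (hI : I ≠ 0) (hJ : J ≠ 0)
    (h : ∀ v : HeightOneSpectrum R, FractionalIdeal.count K v I = FractionalIdeal.count K v J) :
    I = J := by
  rw [← FractionalIdeal.finprod_heightOneSpectrum_factorization' K hI,
    ← FractionalIdeal.finprod_heightOneSpectrum_factorization' K hJ]
  exact finprod_congr fun v ↦ by rw [h v]

theorem exists_unit_of_valuation_eq_one (x : Kˣ)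
    (h : ∀ v : HeightOneSpectrum R, v.valuationOfNeZero x = 1) :
    ∃ u : Rˣ, Units.map (algebraMap R K : R →* K) u = x := by
  have key : ∀ y : Kˣ, (∀ v : HeightOneSpectrum R, v.valuationOfNeZero y = 1) →
      ∃ a : R, algebraMap R K a = y := fun y hy ↦ by
    refine HeightOneSpectrum.mem_integers_of_valuation_le_one K (y : K) fun v ↦ ?_
    rw [← HeightOneSpectrum.valuationOfNeZero_eq, hy v]
    exact le_rfl
  obtain ⟨a, ha⟩ := key x h
  obtain ⟨b, hb⟩ := key x⁻¹ fun v ↦ by rw [map_inv, h v, inv_one]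
  have hab : a * b = 1 := by
    apply IsFractionRing.injective R K
    rw [map_mul, map_one, ha, hb, Units.mul_inv]
  refine ⟨⟨a, b, hab, by rw [mul_comm, hab]⟩, ?_⟩
  ext
  exact ha

theorem mk_eq_one_iff_exists (I : (FractionalIdeal R⁰ K)ˣ) :
    ClassGroup.mk K I = 1 ↔ ∃ x : Kˣ, ∀ v : HeightOneSpectrum R,
      FractionalIdeal.count K v (I : FractionalIdeal R⁰ K) = -(v.valuationOfNeZero x).toAdd := by
  rw [ClassGroup.mk_eq_one_iff]
  constructor
  · intro h
    obtain ⟨x, hx⟩ := (FractionalIdeal.isPrincipal_iff (I : FractionalIdeal R⁰ K)).1 h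
    have hx0 : x ≠ 0 := fun h0 ↦ I.ne_zero (by rw [hx, h0, FractionalIdeal.spanSingleton_zero])
    refine ⟨Units.mk0 x hx0, fun v ↦ ?_⟩
    rw [← count_spanSingleton, Units.val_mk0, hx]
  · rintro ⟨x, hx⟩
    refine (FractionalIdeal.isPrincipal_iff (I : FractionalIdeal R⁰ K)).2
      ⟨x, fractionalIdeal_ext I.ne_zero
      (FractionalIdeal.spanSingleton_ne_zero_iff.2 x.ne_zero) fun v ↦ ?_⟩
    rw [hx v, count_spanSingleton]

theorem exists_fractionalIdeal_count_eq (m : HeightOneSpectrum R →₀ ℤ) :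
    ∃ I : (FractionalIdeal R⁰ K)ˣ, ∀ v,
      FractionalIdeal.count K v (I : FractionalIdeal R⁰ K) = m v := by
  have h0 : (m.prod fun v n ↦ (v.asIdeal : FractionalIdeal R⁰ K) ^ n) ≠ 0 :=
    Finset.prod_ne_zero_iff.2 fun v _ ↦
      zpow_ne_zero _ (FractionalIdeal.coeIdeal_ne_zero.2 v.ne_bot)
  exact ⟨Units.mk0 _ h0, fun v ↦ FractionalIdeal.count_finsuppProd K v m⟩

theorem finite_valuation_ne_one (x : Kˣ) :
    {v : HeightOneSpectrum R | v.valuationOfNeZero x ≠ 1}.Finite := by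
  have h := FractionalIdeal.finite_factors (FractionalIdeal.spanSingleton R⁰ (x : K))
  rw [Filter.eventually_cofinite] at h
  refine h.subset fun v hv h0 ↦ hv ?_
  rw [count_spanSingleton, neg_eq_zero] at h0
  exact h0

end Dedekind

/-! ### Valuations in Galois extensions of number fields -/

section Galois

open IsDedekindDomain nonZeroDivisors Pointwise

set_option maxSynthPendingDepth 3

variable {L F : Type} [Field L] [Field F] [Algebra L F]

theorem algebraMap_smul_ringOfIntegers (s : Gal(F/L)) (x : 𝓞 F) :
    algebraMap (𝓞 F) F (s • x) = s (algebraMap (𝓞 F) F x) := rfl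

theorem exists_liesOver (v : HeightOneSpectrum (𝓞 L)) :
    ∃ P : HeightOneSpectrum (𝓞 F), P.asIdeal.LiesOver v.asIdeal := by
  obtain ⟨P, hP1, hP2⟩ := (inferInstance : Nonempty (v.asIdeal.primesOver (𝓞 F)))
  exact ⟨⟨P, hP1, Ideal.ne_bot_of_liesOver_of_ne_bot v.ne_bot P⟩, hP2⟩

theorem exists_under (P : HeightOneSpectrum (𝓞 F)) :
    ∃ v : HeightOneSpectrum (𝓞 L), P.asIdeal.LiesOver v.asIdeal :=
  ⟨⟨P.asIdeal.under (𝓞 L), inferInstance, mt Ideal.eq_bot_of_comap_eq_bot P.ne_bot⟩,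
    inferInstanceAs (P.asIdeal.LiesOver (P.asIdeal.under (𝓞 L)))⟩

variable [NumberField F]

theorem valuation_smul (s : Gal(F/L)) (P Q : HeightOneSpectrum (𝓞 F))
    (h : s • P.asIdeal = Q.asIdeal) (z : Fˣ) :
    Q.valuationOfNeZero (Units.map (s : F →* F) z) = P.valuationOfNeZero z := by
  have hint : ∀ x : 𝓞 F, Q.intValuation (s • x) = P.intValuation x := fun x ↦ by
    by_cases hx : x = 0
    · rw [hx, smul_zero, map_zero, map_zero]
    have hx' : s • x ≠ 0 := fun h0 ↦ hx (by simpa using congrArg (s⁻¹ • ·) h0)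
    -- Orders are compared through `x ∈ P^n ↔ s x ∈ (sP)^n = Q^n`.
    have key : ∀ n : ℕ, Q.intValuation (s • x) ≤ WithZero.exp (-(n : ℤ)) ↔
        P.intValuation x ≤ WithZero.exp (-(n : ℤ)) := fun n ↦ by
      rw [HeightOneSpectrum.intValuation_le_pow_iff_mem,
        HeightOneSpectrum.intValuation_le_pow_iff_mem, ← h, ← smul_pow',
        Ideal.smul_mem_pointwise_smul_iff]
    rw [Q.intValuation_eq_exp_neg_multiplicity hx', P.intValuation_eq_exp_neg_multiplicity hx]
      at key ⊢
    refine le_antisymm ((key _).2 le_rfl) ((key _).1 le_rfl)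
  rw [← WithZero.coe_inj, HeightOneSpectrum.valuationOfNeZero_eq,
    HeightOneSpectrum.valuationOfNeZero_eq]
  obtain ⟨n, d, hd, hz⟩ := IsFractionRing.div_surjective (A := 𝓞 F) (z : F)
  have h1 : ((Units.map (s : F →* F) z : Fˣ) : F) =
      algebraMap (𝓞 F) F (s • n) / algebraMap (𝓞 F) F (s • d) := by
    rw [algebraMap_smul_ringOfIntegers, algebraMap_smul_ringOfIntegers, ← map_div₀, hz]
    rfl
  rw [h1, ← hz, map_div₀, map_div₀, HeightOneSpectrum.valuation_of_algebraMap,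
    HeightOneSpectrum.valuation_of_algebraMap, HeightOneSpectrum.valuation_of_algebraMap,
    HeightOneSpectrum.valuation_of_algebraMap, hint, hint]

variable [NumberField L]

theorem valuation_algebraMap (v : HeightOneSpectrum (𝓞 L)) (P : HeightOneSpectrum (𝓞 F))
    [P.asIdeal.LiesOver v.asIdeal] (x : Lˣ) :
    P.valuationOfNeZero (Units.map (algebraMap L F : L →* F) x) =
      v.valuationOfNeZero x ^ (P.asIdeal.ramificationIdx (𝓞 L)) := by
  have h := HeightOneSpectrum.valuation_liesOver F v P (x : L)
  rw [Ideal.ramificationIdx'_eq_ramificationIdx _ _ v.ne_bot] at h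
  rw [← WithZero.coe_inj, HeightOneSpectrum.valuationOfNeZero_eq, WithZero.coe_pow,
    HeightOneSpectrum.valuationOfNeZero_eq, h]
  rfl

theorem exists_smul_eq [IsGalois L F] (v : HeightOneSpectrum (𝓞 L)) (P Q : HeightOneSpectrum (𝓞 F))
    [P.asIdeal.LiesOver v.asIdeal] [Q.asIdeal.LiesOver v.asIdeal] :
    ∃ s : Gal(F/L), s • P.asIdeal = Q.asIdeal :=
  Ideal.exists_smul_eq_of_isGaloisGroup v.asIdeal P.asIdeal Q.asIdeal Gal(F/L)

theorem ramificationIdx_eq [IsGalois L F] (v : HeightOneSpectrum (𝓞 L))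
    (P Q : HeightOneSpectrum (𝓞 F))
    [P.asIdeal.LiesOver v.asIdeal] [Q.asIdeal.LiesOver v.asIdeal] :
    P.asIdeal.ramificationIdx (𝓞 L) = Q.asIdeal.ramificationIdx (𝓞 L) :=
  Ideal.ramificationIdx_eq_of_isGaloisGroup v.asIdeal P.asIdeal Q.asIdeal Gal(F/L)

theorem ramificationIdx_ne_zero (P : HeightOneSpectrum (𝓞 F)) :
    P.asIdeal.ramificationIdx (𝓞 L) ≠ 0 :=
  (Ideal.ramificationIdx_pos _ _).ne'

-- Ramified primes lie below divisors of the different. Finiteness makes `ncard` a genuine count: an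
-- infinite set would have `ncard` zero.
variable (L F) in
theorem finite_ramifiedPrimes : (ramifiedPrimes L F).Finite := by
  have h1 : {P : HeightOneSpectrum (𝓞 F) | P.asIdeal ∣ differentIdeal (𝓞 L) (𝓞 F)}.Finite :=
    Ideal.finite_factors (differentIdeal_ne_bot)
  choose u hu using exists_under (L := L) (F := F)
  refine (h1.image u).subset ?_
  rintro v ⟨P, hP, hPv, hne⟩
  let P' : HeightOneSpectrum (𝓞 F) := ⟨P, hP, Ideal.ne_bot_of_liesOver_of_ne_bot v.ne_bot P⟩
  refine ⟨P', ?_, ?_⟩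
  · change P ∣ _
    rw [dvd_differentIdeal_iff]
    intro hun
    exact hne (Ideal.ramificationIdx_eq_one _ _)
  · ext1
    exact (hu P').over.trans hPv.over.symm

end Galois

end GaloisUnits

end

noncomputable section

namespace GaloisUnits

/-! ### Elements with Galois-invariant divisor -/

section Index

/-- The map `f` need not be a homomorphism: its values on coset representatives already separate
cosets of `D`. -/
theorem relIndex_le_card {A X : Type} [CommGroup A] [Finite X] (D Z : Subgroup A) (f : Z → X)
    (hf : ∀ a b : Z, f a = f b → (a / b : A) ∈ D) :
    D.relIndex Z ≤ Nat.card X ∧ D.relIndex Z ≠ 0 := by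
  let F : Z ⧸ D.subgroupOf Z → X := fun q ↦ f q.out
  have hF : Function.Injective F := fun q q' h ↦ by
    have h1 := hf _ _ h
    rw [← QuotientGroup.out_eq' q, ← QuotientGroup.out_eq' q', QuotientGroup.eq_iff_div_mem,
      Subgroup.mem_subgroupOf]
    exact h1
  have := Finite.of_injective F hF
  exact ⟨Nat.card_le_card_of_injective F hF, Nat.card_pos.ne'⟩

theorem card_pow_eq_one_le {G : Type} [CommGroup G] [IsCyclic G] [Finite G] {n : ℕ} (hn : 0 < n) :
    Nat.card {a : G // a ^ n = 1} ≤ n := by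
  classical
  have := Fintype.ofFinite G
  rw [Nat.card_eq_fintype_card, Fintype.card_subtype]
  exact IsCyclic.card_pow_eq_one_le hn

theorem card_pi_pow_eq_one_le {ι : Type} [Finite ι] {G : ι → Type} [∀ i, CommGroup (G i)]
    [∀ i, IsCyclic (G i)] [∀ i, Finite (G i)] {n : ℕ} (hn : 0 < n) :
    Nat.card {a : ∀ i, G i // a ^ n = 1} ≤ n ^ Nat.card ι := by
  have := Fintype.ofFinite ι
  have e : {a : ∀ i, G i // a ^ n = 1} ≃ ∀ i, {b : G i // b ^ n = 1} :=
    (Equiv.subtypeEquivRight fun a ↦ funext_iff).trans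
      (Equiv.subtypePiEquivPi (p := fun _ b ↦ b ^ n = 1))
  rw [Nat.card_congr e, Nat.card_pi, Nat.card_eq_fintype_card, ← Finset.card_univ]
  exact Finset.prod_le_pow_card _ _ _ fun i _ ↦ card_pow_eq_one_le hn

end Index

section Divisors

open IsDedekindDomain nonZeroDivisors Pointwise

set_option maxSynthPendingDepth 3

variable {L F : Type} [Field L] [Field F] [Algebra L F]

variable (F) in
/-- The units of the ring of integers, as a subgroup of `Fˣ`. -/
def integerUnits : Subgroup Fˣ := (Units.map (algebraMap (𝓞 F) F : 𝓞 F →* F)).range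

variable (L F) in
/-- The subgroup of `Fˣ` generated by `Lˣ` and by the units of the ring of integers. -/
def baseMulUnits : Subgroup Fˣ := (Units.map (algebraMap L F : L →* F)).range ⊔ integerUnits F

/-- The homomorphism `z ↦ s z / z`. -/
def galDiv (s : Gal(F/L)) : Fˣ →* Fˣ := Units.map (s : F →* F) / MonoidHom.id Fˣ

theorem galDiv_apply (s : Gal(F/L)) (z : Fˣ) : galDiv s z = Units.map (s : F →* F) z / z := rfl

theorem map_mem_integerUnits (s : Gal(F/L)) {u : Fˣ} (hu : u ∈ integerUnits F) :
    Units.map (s : F →* F) u ∈ integerUnits F := by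
  obtain ⟨w, rfl⟩ := hu
  exact ⟨galUnits s w, by ext; rfl⟩

theorem galDiv_pow_mem (s : Gal(F/L)) {z : Fˣ} (hz : galDiv s z ∈ integerUnits F) (n : ℕ) :
    galDiv (s ^ n) z ∈ integerUnits F := by
  induction n with
  | zero =>
    have h : galDiv (s ^ 0) z = 1 := by
      rw [pow_zero, galDiv_apply]
      exact div_self' z
    rw [h]
    exact one_mem _
  | succ n ih =>
    have h : galDiv (s ^ (n + 1)) z =
        Units.map ((s ^ n : Gal(F/L)) : F →* F) (galDiv s z) * galDiv (s ^ n) z := by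
      rw [galDiv_apply, galDiv_apply, galDiv_apply, map_div, div_mul_div_cancel, pow_succ]
      rfl
    rw [h]
    exact mul_mem (map_mem_integerUnits _ hz) ih

variable [NumberField L] [NumberField F]

theorem valuation_of_mem_integerUnits {u : Fˣ} (hu : u ∈ integerUnits F)
    (P : HeightOneSpectrum (𝓞 F)) : P.valuationOfNeZero u = 1 := by
  obtain ⟨w, rfl⟩ := hu
  exact P.valuation_of_unit_eq w

/-- If `s z / z` is a unit, the divisor of `z` is Galois-invariant, and the Galois group permutes
the primes above `v` transitively. -/
theorem valuation_eq_of_galDiv_mem [IsGalois L F] {s : Gal(F/L)}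
    (hs : ∀ t, t ∈ Subgroup.zpowers s) {z : Fˣ} (hz : galDiv s z ∈ integerUnits F)
    (v : HeightOneSpectrum (𝓞 L)) (P Q : HeightOneSpectrum (𝓞 F))
    [P.asIdeal.LiesOver v.asIdeal] [Q.asIdeal.LiesOver v.asIdeal] :
    P.valuationOfNeZero z = Q.valuationOfNeZero z := by
  obtain ⟨t, ht⟩ := exists_smul_eq v P Q
  obtain ⟨n, rfl⟩ := (mem_powers_iff_mem_zpowers (x := s) (y := t)).2 (hs t)
  have h1 := valuation_of_mem_integerUnits (galDiv_pow_mem s hz n) Q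
  rw [galDiv_apply, map_div, div_eq_one] at h1
  rw [← h1]
  exact (valuation_smul _ P Q ht z).symm

/-- The principal fractional ideal `(z)` is the extension of the fractional ideal `J` of `L`. -/
def IsExtensionOf (z : Fˣ) (J : (FractionalIdeal (𝓞 L)⁰ L)ˣ) : Prop :=
  ∀ (v : HeightOneSpectrum (𝓞 L)) (P : HeightOneSpectrum (𝓞 F)), P.asIdeal.LiesOver v.asIdeal →
    (P.valuationOfNeZero z).toAdd = -(P.asIdeal.ramificationIdx (𝓞 L) *
      FractionalIdeal.count L v (J : FractionalIdeal (𝓞 L)⁰ L))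

/-- From `z^n = xu`, the ideals `J^n` and `(x)` have the same extension to `F`; cancelling
ramification indices gives `J^n = (x)`. -/
theorem IsExtensionOf.mk_pow_eq_one {z : Fˣ} {J : (FractionalIdeal (𝓞 L)⁰ L)ˣ}
    (h : IsExtensionOf z J) {n : ℕ} (hz : z ^ n ∈ baseMulUnits L F) :
    ClassGroup.mk L J ^ n = 1 := by
  obtain ⟨_, ⟨x, rfl⟩, u, hu, hxu⟩ := Subgroup.mem_sup.1 hz
  rw [← map_pow, mk_eq_one_iff_exists]
  refine ⟨x, fun v ↦ ?_⟩
  obtain ⟨P, hP⟩ := exists_liesOver (F := F) v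
  have h1 := congrArg (fun y ↦ (P.valuationOfNeZero y).toAdd) hxu
  simp only [map_mul, map_pow, valuation_algebraMap v P, valuation_of_mem_integerUnits hu, mul_one,
    toAdd_pow, h v P hP, nsmul_eq_mul] at h1
  rw [Units.val_pow_eq_pow_val, FractionalIdeal.count_pow]
  have he : (P.asIdeal.ramificationIdx (𝓞 L) : ℤ) ≠ 0 :=
    Nat.cast_ne_zero.2 (ramificationIdx_ne_zero P)
  apply mul_left_cancel₀ he
  linear_combination h1

/-- If `J / J' = (x)`, then `z / (z' x)` has trivial valuation everywhere, hence is a unit. -/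
theorem IsExtensionOf.div_mem {z z' : Fˣ} {J J' : (FractionalIdeal (𝓞 L)⁰ L)ˣ}
    (h : IsExtensionOf z J) (h' : IsExtensionOf z' J')
    (hJ : ClassGroup.mk L J = ClassGroup.mk L J') : z / z' ∈ baseMulUnits L F := by
  rw [← div_eq_one, ← map_div, mk_eq_one_iff_exists] at hJ
  obtain ⟨x, hx⟩ := hJ
  have hx' : ∀ v, FractionalIdeal.count L v (J : FractionalIdeal (𝓞 L)⁰ L) -
      FractionalIdeal.count L v (J' : FractionalIdeal (𝓞 L)⁰ L) =
      -(v.valuationOfNeZero x).toAdd := fun v ↦ by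
    rw [← hx v, Units.val_div_eq_div_val, div_eq_mul_inv,
      FractionalIdeal.count_mul L v J.ne_zero (inv_ne_zero J'.ne_zero), FractionalIdeal.count_inv,
      sub_eq_add_neg]
  obtain ⟨u, hu⟩ := exists_unit_of_valuation_eq_one (R := 𝓞 F)
    (z / z' / Units.map (algebraMap L F : L →* F) x) fun P ↦ by
      obtain ⟨v, hv⟩ := exists_under (L := L) P
      apply Multiplicative.toAdd.injective
      rw [map_div P.valuationOfNeZero, map_div P.valuationOfNeZero, valuation_algebraMap v P,
        toAdd_div, toAdd_div, h v P hv, h' v P hv,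
        toAdd_pow, nsmul_eq_mul, toAdd_one]
      linear_combination (-(P.asIdeal.ramificationIdx (𝓞 L) : ℤ)) * hx' v
  rw [eq_div_iff_mul_eq'] at hu
  rw [← hu, mul_comm]
  exact Subgroup.mul_mem_sup ⟨x, rfl⟩ ⟨u, rfl⟩

theorem exists_isExtensionOf [IsGalois L F] {s : Gal(F/L)}
    (hs : ∀ t, t ∈ Subgroup.zpowers s) {z : Fˣ} (hz : galDiv s z ∈ integerUnits F)
    (P : HeightOneSpectrum (𝓞 L) → HeightOneSpectrum (𝓞 F))
    (hP : ∀ v, (P v).asIdeal.LiesOver v.asIdeal)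
    (hd : ∀ v, (((P v).asIdeal.ramificationIdx (𝓞 L) : ℕ) : ℤ) ∣
      ((P v).valuationOfNeZero z).toAdd) :
    ∃ J : (FractionalIdeal (𝓞 L)⁰ L)ˣ, IsExtensionOf z J := by
  choose m hm using hd
  have hPinj : Function.Injective P := fun v w h ↦ by
    ext1
    rw [(hP v).over, (hP w).over, h]
  have hfin : {v | m v ≠ 0}.Finite := by
    refine ((finite_valuation_ne_one z).preimage hPinj.injOn).subset fun v hv h1 ↦ hv ?_
    have h2 := hm v
    rw [h1, toAdd_one] at h2
    exact (mul_eq_zero.1 h2.symm).resolve_left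
      (Nat.cast_ne_zero.2 (ramificationIdx_ne_zero (P v)))
  obtain ⟨J, hJ⟩ := exists_fractionalIdeal_count_eq (R := 𝓞 L) (K := L)
    (-Finsupp.ofSupportFinite m hfin)
  refine ⟨J, fun v Q hQ ↦ ?_⟩
  have := hP v
  rw [hJ v, ← valuation_eq_of_galDiv_mem hs hz v (P v) Q, hm v, ramificationIdx_eq v (P v) Q]
  change _ = -(_ * -(m v))
  ring

-- Multiplication by `p` on a finite abelian group has kernel and cokernel of equal order.
variable (L) in
theorem card_classGroup_pow_eq_one (p : ℕ) [Fact p.Prime] :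
    Nat.card {c : ClassGroup (𝓞 L) // c ^ p = 1} = p ^ classGroupRank L p := by
  have : Finite (ModN (Additive (ClassGroup (𝓞 L))) p) := inferInstance
  have h1 : Nat.card (ModN (Additive (ClassGroup (𝓞 L))) p) = p ^ classGroupRank L p := by
    rw [Module.natCard_eq_pow_finrank (K := ZMod p), Nat.card_zmod]
    rfl
  rw [← h1]
  have h2 := AddSubgroup.index_range (f := nsmulAddMonoidHom (α := Additive (ClassGroup (𝓞 L))) p)
  have h3 : (LinearMap.range (LinearMap.lsmul ℤ (Additive (ClassGroup (𝓞 L))) p)).toAddSubgroup =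
      (nsmulAddMonoidHom (α := Additive (ClassGroup (𝓞 L))) p).range := by
    ext x
    simp [AddMonoidHom.mem_range, LinearMap.mem_range]
  rw [← h3] at h2
  exact h2.symm

/-- The residue modulo the ramification indices of the orders of an element at chosen primes above
the ramified primes. -/
def ramifiedOrders (P : HeightOneSpectrum (𝓞 L) → HeightOneSpectrum (𝓞 F)) :
    Fˣ →* ∀ v : ramifiedPrimes L F,
      Multiplicative (ZMod ((P v).asIdeal.ramificationIdx (𝓞 L))) :=
  MonoidHom.pi fun v ↦
    (Int.castAddHom (ZMod ((P v).asIdeal.ramificationIdx (𝓞 L)))).toMultiplicative.comp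
      (P v).valuationOfNeZero

omit [NumberField L] in
theorem ramifiedOrders_apply (P : HeightOneSpectrum (𝓞 L) → HeightOneSpectrum (𝓞 F)) (z : Fˣ)
    (v : ramifiedPrimes L F) :
    ramifiedOrders P z v = Multiplicative.ofAdd
      ((((P v).valuationOfNeZero z).toAdd : ℤ) :
        ZMod ((P v).asIdeal.ramificationIdx (𝓞 L))) := rfl

theorem ramifiedOrders_eq_one (P : HeightOneSpectrum (𝓞 L) → HeightOneSpectrum (𝓞 F))
    (hP : ∀ v, (P v).asIdeal.LiesOver v.asIdeal) {z : Fˣ} (hz : z ∈ baseMulUnits L F) :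
    ramifiedOrders P z = 1 := by
  obtain ⟨_, ⟨x, rfl⟩, u, hu, rfl⟩ := Subgroup.mem_sup.1 hz
  funext v
  have := hP v
  rw [ramifiedOrders_apply, map_mul, valuation_of_mem_integerUnits hu, mul_one,
    valuation_algebraMap (v : HeightOneSpectrum (𝓞 L)), toAdd_pow, nsmul_eq_mul, Int.cast_mul,
    Int.cast_natCast, ZMod.natCast_self, zero_mul]
  rfl

/-- A two-step filtration. Orders modulo `e_v` at the ramified primes land in the `p`-torsion of
cyclic groups, giving at most `p^r`. Where they vanish, the divisor of `z` is extended from an ideal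
`J` of `L`, and the class of `J` in `Cl_L[p]` determines `z` modulo `L^× 𝓞_F^×`. -/
theorem relIndex_baseMulUnits_le [IsGalois L F] {s : Gal(F/L)}
    (hs : ∀ t, t ∈ Subgroup.zpowers s) (p : ℕ) [Fact p.Prime] :
    (baseMulUnits L F).relIndex ((integerUnits F).comap (galDiv s) ⊓
      (baseMulUnits L F).comap (powMonoidHom p)) ≤
        p ^ ((ramifiedPrimes L F).ncard + classGroupRank L p) ∧
    (baseMulUnits L F).relIndex ((integerUnits F).comap (galDiv s) ⊓
      (baseMulUnits L F).comap (powMonoidHom p)) ≠ 0 := by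
  choose P hP using exists_liesOver (L := L) (F := F)
  have : Finite (ramifiedPrimes L F) := (finite_ramifiedPrimes L F).to_subtype
  have hne : ∀ v, NeZero ((P v).asIdeal.ramificationIdx (𝓞 L)) := fun v ↦
    ⟨ramificationIdx_ne_zero (P v)⟩
  set Z := (integerUnits F).comap (galDiv s) ⊓ (baseMulUnits L F).comap (powMonoidHom p)
  set Ψ := ramifiedOrders P
  have hker : baseMulUnits L F ≤ Ψ.ker := fun z hz ↦ ramifiedOrders_eq_one P hP hz
  have hram := relIndex_le_card Ψ.ker Z (X := {a : ∀ v : ramifiedPrimes L F,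
      Multiplicative (ZMod ((P v).asIdeal.ramificationIdx (𝓞 L))) // a ^ p = 1})
    (fun z ↦ ⟨Ψ z, by rw [← map_pow]; exact hker z.2.2⟩) fun a b h ↦ by
      rw [MonoidHom.mem_ker, map_div, div_eq_one]
      exact congrArg Subtype.val h
  have hcl : ∀ z : (Z ⊓ Ψ.ker : Subgroup Fˣ),
      ∃ J : (FractionalIdeal (𝓞 L)⁰ L)ˣ, IsExtensionOf (z : Fˣ) J := fun z ↦ by
    refine exists_isExtensionOf hs z.2.1.1 P hP fun v ↦ ?_
    by_cases hv : v ∈ ramifiedPrimes L F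
    · have h1 := congrFun (show Ψ z = 1 from z.2.2) ⟨v, hv⟩
      change Multiplicative.ofAdd _ = Multiplicative.ofAdd (0 : ZMod _) at h1
      exact (ZMod.intCast_zmod_eq_zero_iff_dvd _ _).1 (Multiplicative.ofAdd.injective h1)
    · have h1 : (P v).asIdeal.ramificationIdx (𝓞 L) = 1 := by
        by_contra h
        exact hv ⟨(P v).asIdeal, (P v).isPrime, hP v, h⟩
      rw [h1]
      exact one_dvd _
  choose J hJ using hcl
  have hclass := relIndex_le_card (baseMulUnits L F) (Z ⊓ Ψ.ker)
    (X := {c : ClassGroup (𝓞 L) // c ^ p = 1})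
    (fun z ↦ ⟨ClassGroup.mk L (J z), (hJ z).mk_pow_eq_one z.2.1.2⟩) fun a b h ↦
      (hJ a).div_mem (hJ b) (congrArg Subtype.val h)
  rw [card_classGroup_pow_eq_one, inf_comm] at hclass
  have hmul : (baseMulUnits L F).relIndex (Ψ.ker ⊓ Z) * Ψ.ker.relIndex Z =
      (baseMulUnits L F).relIndex Z := by
    rw [Subgroup.relIndex_inf_mul_relIndex, inf_eq_left.2 hker]
  have hr := hram.1.trans (card_pi_pow_eq_one_le (Fact.out : p.Prime).pos)
  rw [Nat.card_coe_set_eq] at hr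
  rw [← hmul, add_comm, pow_add]
  exact ⟨Nat.mul_le_mul hclass.1 hr, mul_ne_zero hclass.2 hram.2⟩

end Divisors

end GaloisUnits

end

noncomputable section

namespace GaloisUnits

/-! ### Norm-one units modulo `σ - 1` -/

section Lattice

open Polynomial

variable {M : Type} [AddCommGroup M] (h : M →ₗ[ℤ] M)

/-- The image of `h - 1`. -/
def coboundaries : AddSubgroup M := (LinearMap.range (aeval h (X - 1 : ℤ[X]))).toAddSubgroup

/-- The kernel of `1 + h + ⋯ + h ^ (n - 1)`. -/
def normKer (n : ℕ) : AddSubgroup M :=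
  (LinearMap.ker (aeval h (geom (X : ℤ[X]) n))).toAddSubgroup

variable {h}

theorem mem_coboundaries {m : M} : m ∈ coboundaries h ↔ ∃ y, h y - y = m := by
  change (∃ y, aeval h (X - 1 : ℤ[X]) y = m) ↔ _
  simp

theorem mem_normKer {n : ℕ} {m : M} :
    m ∈ normKer h n ↔ ∑ i ∈ Finset.range n, (h ^ i) m = 0 := by
  change aeval h (geom (X : ℤ[X]) n) m = 0 ↔ _
  simp [geom]

theorem coboundaries_le_normKer {n : ℕ} (hn : h ^ n = 1) : coboundaries h ≤ normKer h n := by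
  rintro _ ⟨y, rfl⟩
  change aeval h (geom (X : ℤ[X]) n) (aeval h (X - 1 : ℤ[X]) y) = 0
  rw [← Module.End.mul_apply, ← map_mul, mul_comm, sub_one_mul_geom]
  simp [hn]

theorem map_nsmul_normKer_le {n : ℕ} (k : ℕ) :
    (normKer h n).map (nsmulAddMonoidHom k) ≤ normKer h n := by
  rintro _ ⟨y, hy, rfl⟩
  exact nsmul_mem hy k

theorem map_nsmul_coboundaries_le (k : ℕ) :
    (coboundaries h).map (nsmulAddMonoidHom k) ≤ coboundaries h := by
  rintro _ ⟨y, hy, rfl⟩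
  exact nsmul_mem hy k

theorem nsmul_mem_coboundaries {n : ℕ} {m : M} (hm : m ∈ normKer h n) :
    n • m ∈ coboundaries h := by
  obtain ⟨u, hu⟩ := exists_geom_eq (X : ℤ[X]) n
  change aeval h (geom (X : ℤ[X]) n) m = 0 at hm
  rw [hu, map_add, map_natCast, map_mul, LinearMap.add_apply, Module.End.mul_apply] at hm
  have h1 : (n : Module.End ℤ M) m = n • m := by simp
  rw [h1] at hm
  rw [eq_neg_of_add_eq_zero_left hm]
  exact neg_mem ⟨_, rfl⟩

/-- The quotient is finitely generated and killed by `n`. -/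
theorem relIndex_coboundaries_ne_zero [Module.Finite ℤ M] {n : ℕ} (hn : n ≠ 0) :
    (coboundaries h).relIndex (normKer h n) ≠ 0 := by
  have h1 : Module.Finite ℤ (LinearMap.ker (aeval h (geom (X : ℤ[X]) n))) := inferInstance
  have : AddGroup.FG (normKer h n) := Module.Finite.iff_addGroup_fg.1 h1
  have : Finite (normKer h n ⧸ (coboundaries h).addSubgroupOf (normKer h n)) := by
    apply AddCommGroup.finite_of_fg_isAddTorsion
    rintro x
    induction x using QuotientAddGroup.induction_on with
    | H x =>
      rw [isOfFinAddOrder_iff_nsmul_eq_zero]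
      refine ⟨n, Nat.pos_of_ne_zero hn, ?_⟩
      rw [← QuotientAddGroup.mk_nsmul, QuotientAddGroup.eq_zero_iff]
      exact nsmul_mem_coboundaries x.2
  exact Nat.card_pos.ne'

theorem relIndex_sup_nsmul_eq [Module.Finite ℤ M] {n : ℕ} (hn : n ≠ 0) (hh : h ^ n = 1) (k : ℕ) :
    (coboundaries h ⊔ (normKer h n).map (nsmulAddMonoidHom k)).relIndex (normKer h n) =
      (coboundaries h).relIndex (normKer h n ⊓ (coboundaries h).comap (nsmulAddMonoidHom k)) :=
  relIndex_sup_map_eq _ (coboundaries_le_normKer hh) (map_nsmul_normKer_le k)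
    (map_nsmul_coboundaries_le k) (relIndex_coboundaries_ne_zero hn)

end Lattice

/-! ### Cohomology of the units via Hilbert 90, and passage to units modulo torsion -/

section Units

set_option maxSynthPendingDepth 3

variable {L F : Type} [Field L] [Field F] [Algebra L F]

/-- The action of a Galois automorphism on the units, written additively. -/
def galUnitsAdd (s : Gal(F/L)) : Additive (𝓞 F)ˣ →ₗ[ℤ] Additive (𝓞 F)ˣ :=
  (MonoidHom.toAdditive (galUnits s)).toIntLinearMap

theorem galUnitsAdd_pow_apply (s : Gal(F/L)) (i : ℕ) (u : (𝓞 F)ˣ) :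
    (galUnitsAdd s ^ i) (Additive.ofMul u) = Additive.ofMul (galUnits (s ^ i) u) := by
  induction i with
  | zero =>
    rw [pow_zero, pow_zero]
    apply congrArg Additive.ofMul
    ext
    rfl
  | succ i ih =>
    rw [pow_succ', Module.End.mul_apply, ih, pow_succ']
    apply congrArg Additive.ofMul
    ext
    rfl

theorem galUnitsAdd_pow_eq_one {s : Gal(F/L)} {n : ℕ} (hs : s ^ n = 1) : galUnitsAdd s ^ n = 1 := by
  refine LinearMap.ext fun x ↦ ?_
  change (galUnitsAdd s ^ n) (Additive.ofMul x.toMul) = _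
  rw [galUnitsAdd_pow_apply, hs]
  rfl

/-- The inclusion of the units into the multiplicative group of the field. -/
def unitsAddHom (F : Type) [Field F] : Additive (𝓞 F)ˣ →+ Additive Fˣ :=
  MonoidHom.toAdditive (Units.map (algebraMap (𝓞 F) F : 𝓞 F →* F))

theorem unitsAddHom_injective : Function.Injective (unitsAddHom F) :=
  Units.map_injective (FaithfulSMul.algebraMap_injective (𝓞 F) F)

variable (L F) in
theorem unitsMap_injective :
    Function.Injective (Units.map (algebraMap (𝓞 L) (𝓞 F) : 𝓞 L →* 𝓞 F)) :=
  Units.map_injective (FaithfulSMul.algebraMap_injective (𝓞 L) (𝓞 F))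

variable [NumberField F]

/-- The projection of the units onto the units modulo torsion. -/
def unitsModTorsionHom (F : Type) [Field F] [NumberField F] :
    Additive (𝓞 F)ˣ →+ UnitsModTorsion F :=
  MonoidHom.toAdditive (QuotientGroup.mk' (NumberField.Units.torsion F))

theorem unitsModTorsionHom_surjective : Function.Surjective (unitsModTorsionHom F) :=
  QuotientGroup.mk'_surjective (NumberField.Units.torsion F)

theorem unitsModTorsionHom_galUnitsAdd (s : Gal(F/L)) (u : Additive (𝓞 F)ˣ) :
    unitsModTorsionHom F (galUnitsAdd s u) = galUnitsModTorsion s (unitsModTorsionHom F u) := rfl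

theorem unitsModTorsionHom_pow (s : Gal(F/L)) (i : ℕ) (u : Additive (𝓞 F)ˣ) :
    unitsModTorsionHom F ((galUnitsAdd s ^ i) u) =
      (galUnitsModTorsion s ^ i) (unitsModTorsionHom F u) := by
  induction i with
  | zero => rfl
  | succ i ih =>
    rw [pow_succ', Module.End.mul_apply, unitsModTorsionHom_galUnitsAdd, ih, pow_succ',
      Module.End.mul_apply]

theorem map_coboundaries (s : Gal(F/L)) :
    (coboundaries (galUnitsAdd s)).map (unitsModTorsionHom F) =
      coboundaries (galUnitsModTorsion s) := by
  ext m
  constructor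
  · rintro ⟨u, hu, rfl⟩
    obtain ⟨w, rfl⟩ := mem_coboundaries.1 hu
    exact mem_coboundaries.2 ⟨unitsModTorsionHom F w, by
      rw [map_sub, unitsModTorsionHom_galUnitsAdd]⟩
  · intro hm
    obtain ⟨e, rfl⟩ := mem_coboundaries.1 hm
    obtain ⟨w, rfl⟩ := unitsModTorsionHom_surjective e
    exact ⟨galUnitsAdd s w - w, mem_coboundaries.2 ⟨w, rfl⟩, by
      rw [map_sub, unitsModTorsionHom_galUnitsAdd]⟩

variable [NumberField L] [IsGalois L F]

theorem prod_range_pow_eq_norm {s : Gal(F/L)} (hs : ∀ t, t ∈ Subgroup.zpowers s) (x : F) :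
    ∏ i ∈ Finset.range (Nat.card Gal(F/L)), (s ^ i) x = algebraMap L F (Algebra.norm L x) := by
  classical
  rw [Algebra.norm_eq_prod_automorphisms, ← IsCyclic.image_range_card hs, Finset.prod_image]
  intro i hi j hj hij
  refine pow_injOn_Iio_orderOf (x := s) ?_ ?_ hij
  · rw [orderOf_eq_card_of_forall_mem_zpowers hs]
    exact Finset.mem_range.1 hi
  · rw [orderOf_eq_card_of_forall_mem_zpowers hs]
    exact Finset.mem_range.1 hj

theorem sum_galUnitsAdd_pow {s : Gal(F/L)} (hs : ∀ t, t ∈ Subgroup.zpowers s) (u : (𝓞 F)ˣ) :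
    ∑ i ∈ Finset.range (Nat.card Gal(F/L)), (galUnitsAdd s ^ i) (Additive.ofMul u) =
      Additive.ofMul (Units.map (algebraMap (𝓞 L) (𝓞 F) : 𝓞 L →* 𝓞 F)
        (Units.map (RingOfIntegers.norm L) u)) := by
  simp_rw [galUnitsAdd_pow_apply]
  rw [← ofMul_prod]
  apply congrArg Additive.ofMul
  ext
  change algebraMap (𝓞 F) F _ = algebraMap L F (Algebra.norm L ((u : 𝓞 F) : F))
  rw [← prod_range_pow_eq_norm hs, Units.coe_prod, map_prod]
  rfl

theorem mem_normKer_galUnitsAdd {s : Gal(F/L)} (hs : ∀ t, t ∈ Subgroup.zpowers s) (u : (𝓞 F)ˣ) :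
    Additive.ofMul u ∈ normKer (galUnitsAdd s) (Nat.card Gal(F/L)) ↔
      Units.map (RingOfIntegers.norm L) u = 1 := by
  rw [mem_normKer, sum_galUnitsAdd_pow hs]
  change _ = Additive.ofMul 1 ↔ _
  rw [Additive.ofMul.injective.eq_iff, ← map_one (Units.map (algebraMap (𝓞 L) (𝓞 F) : 𝓞 L →* 𝓞 F))]
  exact (unitsMap_injective L F).eq_iff

theorem exists_galDiv_eq {s : Gal(F/L)} (hs : ∀ t, t ∈ Subgroup.zpowers s) {u : (𝓞 F)ˣ}
    (hu : Units.map (RingOfIntegers.norm L) u = 1) :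
    ∃ z : Fˣ, galDiv s z = Units.map (algebraMap (𝓞 F) F : 𝓞 F →* F) u := by
  have : IsCyclic Gal(F/L) := ⟨s, hs⟩
  have h1 : Algebra.norm L ((u : 𝓞 F) : F) = 1 := by
    have := congrArg (fun w : (𝓞 L)ˣ ↦ ((w : 𝓞 L) : L)) hu
    exact this
  obtain ⟨y, hy⟩ := groupCohomology.exists_div_of_norm_eq_one hs h1
  -- Hilbert 90 is used in the form `y / s y = u`, hence the inverse.
  refine ⟨y⁻¹, ?_⟩
  rw [galDiv_apply, map_inv, inv_div_inv]
  ext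
  rw [Units.val_div_eq_div_val]
  exact hy

theorem mem_range_of_galDiv_eq_one {s : Gal(F/L)} (hs : ∀ t, t ∈ Subgroup.zpowers s) {z : Fˣ}
    (hz : galDiv s z = 1) : z ∈ (Units.map (algebraMap L F : L →* F)).range := by
  rw [galDiv_apply, div_eq_one] at hz
  have h1 : s (z : F) = z := congrArg Units.val hz
  have h2 : ∀ t : Gal(F/L), t (z : F) = z := fun t ↦ by
    have h3 : t ∈ MulAction.stabilizer Gal(F/L) (z : F) :=
      Subgroup.zpowers_le.2 (MulAction.mem_stabilizer_iff.2 h1) (hs t)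
    exact h3
  obtain ⟨x, hx⟩ := (IsGalois.mem_range_algebraMap_iff_fixed (F := L) (z : F)).2 h2
  have hx0 : x ≠ 0 := fun h0 ↦ z.ne_zero (by rw [← hx, h0, map_zero])
  exact ⟨Units.mk0 x hx0, by ext; exact hx⟩

/-- By Hilbert 90, `z ↦ s z / z` reaches every norm-one unit, and it carries `L^× 𝓞_F^×` onto the
coboundaries; so the bound on divisors transfers to `H¹(Γ, 𝓞_F^×)[p]`. -/
theorem relIndex_units_le {s : Gal(F/L)} (hs : ∀ t, t ∈ Subgroup.zpowers s) (p : ℕ)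
    [Fact p.Prime] :
    (coboundaries (galUnitsAdd s)).relIndex (normKer (galUnitsAdd s) (Nat.card Gal(F/L)) ⊓
      (coboundaries (galUnitsAdd s)).comap (nsmulAddMonoidHom p)) ≤
        p ^ ((ramifiedPrimes L F).ncard + classGroupRank L p) := by
  obtain ⟨h1, h2⟩ := relIndex_baseMulUnits_le hs p
  set Z := (integerUnits F).comap (galDiv s) ⊓ (baseMulUnits L F).comap (powMonoidHom p)
  let D₀ : AddSubgroup (Additive Fˣ) := Subgroup.toAddSubgroup (baseMulUnits L F)
  let Z₀ : AddSubgroup (Additive Fˣ) := Subgroup.toAddSubgroup Z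
  let θ : Additive Fˣ →+ Additive Fˣ := MonoidHom.toAdditive (galDiv s)
  have h3 : D₀.relIndex Z₀ = (baseMulUnits L F).relIndex Z := rfl
  rw [← h3] at h1 h2
  obtain ⟨h4, h5⟩ := relIndex_map_le θ D₀ Z₀ h2
  have hθ : ∀ w : (𝓞 F)ˣ, galDiv s (Units.map (algebraMap (𝓞 F) F : 𝓞 F →* F) w) =
      Units.map (algebraMap (𝓞 F) F : 𝓞 F →* F) (galUnits s w / w) := fun w ↦ by
    rw [map_div]
    rfl
  have hD : (coboundaries (galUnitsAdd s)).map (unitsAddHom F) = D₀.map θ := by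
    apply le_antisymm
    · rintro _ ⟨m, hm, rfl⟩
      obtain ⟨w, rfl⟩ := mem_coboundaries.1 hm
      exact ⟨unitsAddHom F w, show Units.map _ w.toMul ∈ baseMulUnits L F from
        Subgroup.mem_sup_right ⟨w.toMul, rfl⟩, hθ w.toMul⟩
    · rintro _ ⟨z, hz, rfl⟩
      obtain ⟨_, ⟨x, rfl⟩, _, ⟨w, rfl⟩, hxw⟩ := Subgroup.mem_sup.1 hz
      refine ⟨Additive.ofMul (galUnits s w / w), mem_coboundaries.2 ⟨Additive.ofMul w, rfl⟩, ?_⟩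
      have h6 : galDiv s (Units.map (algebraMap L F : L →* F) x) = 1 := by
        rw [galDiv_apply, div_eq_one]
        ext
        exact s.commutes x
      have h7 : galDiv s z.toMul = _ := (congrArg (galDiv s) hxw).symm
      rw [map_mul, h6, one_mul, hθ] at h7
      exact h7.symm
  have hX : (normKer (galUnitsAdd s) (Nat.card Gal(F/L)) ⊓
      (coboundaries (galUnitsAdd s)).comap (nsmulAddMonoidHom p)).map (unitsAddHom F) ≤
        Z₀.map θ := by
    rintro _ ⟨u, ⟨hu1, hu2⟩, rfl⟩
    obtain ⟨z, hz⟩ := exists_galDiv_eq hs ((mem_normKer_galUnitsAdd hs u.toMul).1 hu1)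
    refine ⟨Additive.ofMul z, ⟨⟨u.toMul, hz.symm⟩, ?_⟩, hz⟩
    obtain ⟨w, hw⟩ := mem_coboundaries.1 hu2
    change z ^ p ∈ baseMulUnits L F
    have hw' : galUnits s w.toMul / w.toMul = u.toMul ^ p := hw
    -- If `u^p = s w / w` and `u = s z / z`, then `z^p / w` is fixed by `s`, so it lies in `L^×`.
    have h6 : galDiv s (z ^ p / Units.map (algebraMap (𝓞 F) F : 𝓞 F →* F) w.toMul) = 1 := by
      rw [map_div, map_pow, hz, hθ, hw', map_pow, div_self']
    have h7 := mem_range_of_galDiv_eq_one hs h6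
    rw [← div_mul_cancel (z ^ p) (Units.map (algebraMap (𝓞 F) F : 𝓞 F →* F) w.toMul)]
    exact Subgroup.mul_mem_sup h7 ⟨_, rfl⟩
  rw [← AddSubgroup.relIndex_map_map_of_injective _ _ unitsAddHom_injective, hD]
  exact (AddSubgroup.relIndex_le_of_le_right hX h5).trans (h4.trans h1)

/-- This is where `N(μ_F) = μ_L` enters: a unit whose norm is a root of unity can be divided by a
root of unity of `F` to have norm one. -/
theorem map_normKer {s : Gal(F/L)} (hs : ∀ t, t ∈ Subgroup.zpowers s) (hN : NormTorsionEq L F) :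
    (normKer (galUnitsAdd s) (Nat.card Gal(F/L))).map (unitsModTorsionHom F) =
      normKer (galUnitsModTorsion s) (Nat.card Gal(F/L)) := by
  have hsum : ∀ u, unitsModTorsionHom F
      (∑ i ∈ Finset.range (Nat.card Gal(F/L)), (galUnitsAdd s ^ i) u) =
      ∑ i ∈ Finset.range (Nat.card Gal(F/L)),
        (galUnitsModTorsion s ^ i) (unitsModTorsionHom F u) := fun u ↦ by
    rw [map_sum]
    exact Finset.sum_congr rfl fun i _ ↦ unitsModTorsionHom_pow s i u
  ext m
  constructor
  · rintro ⟨u, hu, rfl⟩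
    rw [mem_normKer, ← hsum, mem_normKer.1 hu, map_zero]
  · intro hm
    obtain ⟨u, rfl⟩ := unitsModTorsionHom_surjective m
    rw [mem_normKer, ← hsum] at hm
    change unitsModTorsionHom F (∑ i ∈ Finset.range (Nat.card Gal(F/L)),
      (galUnitsAdd s ^ i) (Additive.ofMul u.toMul)) = 0 at hm
    rw [sum_galUnitsAdd_pow hs] at hm
    have h1 := (QuotientGroup.eq_one_iff _).1 hm
    have h2 : Units.map (RingOfIntegers.norm L) u.toMul ∈ NumberField.Units.torsion L :=
by
      obtain ⟨k, hk, h2⟩ := IsOfFinOrder.exists_pow_eq_one h1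
      refine isOfFinOrder_iff_pow_eq_one.2 ⟨k, hk, unitsMap_injective L F ?_⟩
      rw [map_pow, map_one]
      exact h2
    rw [← hN] at h2
    obtain ⟨ζ, hζ, hζu⟩ := h2
    refine ⟨Additive.ofMul (u.toMul / ζ), ?_, ?_⟩
    · apply (mem_normKer_galUnitsAdd hs _).2
      rw [map_div, hζu, div_self']
    · apply (QuotientGroup.eq_iff_div_mem (G := (𝓞 F)ˣ)).2
      change u.toMul / ζ / u.toMul ∈ _
      rw [div_div_cancel_left]
      exact inv_mem hζ

/-- The bound on `H¹[p]` is first turned into one on `H¹/p`, because `H¹/p`, unlike `H¹[p]`, passes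
to quotients of `H¹`. -/
theorem relIndex_unitsModTorsion_le {s : Gal(F/L)} (hs : ∀ t, t ∈ Subgroup.zpowers s)
    (hN : NormTorsionEq L F) (p : ℕ) [Fact p.Prime] :
    (coboundaries (galUnitsModTorsion s) ⊔
      (normKer (galUnitsModTorsion s) (Nat.card Gal(F/L))).map (nsmulAddMonoidHom p)).relIndex
        (normKer (galUnitsModTorsion s) (Nat.card Gal(F/L))) ≤
        p ^ ((ramifiedPrimes L F).ncard + classGroupRank L p) ∧
    (coboundaries (galUnitsModTorsion s) ⊔
      (normKer (galUnitsModTorsion s) (Nat.card Gal(F/L))).map (nsmulAddMonoidHom p)).relIndex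
        (normKer (galUnitsModTorsion s) (Nat.card Gal(F/L))) ≠ 0 := by
  have hcard : Nat.card Gal(F/L) ≠ 0 := Nat.card_pos.ne'
  have hpow : galUnitsAdd s ^ Nat.card Gal(F/L) = 1 := galUnitsAdd_pow_eq_one pow_card_eq_one'
  have h1 := relIndex_units_le hs p
  rw [← relIndex_sup_nsmul_eq hcard hpow] at h1
  have h0 : (coboundaries (galUnitsAdd s) ⊔
      (normKer (galUnitsAdd s) (Nat.card Gal(F/L))).map (nsmulAddMonoidHom p)).relIndex
        (normKer (galUnitsAdd s) (Nat.card Gal(F/L))) ≠ 0 := fun h ↦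
    relIndex_coboundaries_ne_zero hcard (AddSubgroup.relIndex_eq_zero_of_le_left le_sup_left h)
  have h2 := relIndex_map_le (unitsModTorsionHom F) _ _ h0
  have h3 : ((normKer (galUnitsAdd s) (Nat.card Gal(F/L))).map (nsmulAddMonoidHom p)).map
      (unitsModTorsionHom F) = ((normKer (galUnitsAdd s) (Nat.card Gal(F/L))).map
        (unitsModTorsionHom F)).map (nsmulAddMonoidHom p) := by
    rw [AddSubgroup.map_map, AddSubgroup.map_map]
    congr 1
  rw [AddSubgroup.map_sup, h3, map_normKer hs hN, map_coboundaries] at h2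
  exact ⟨h2.1.trans h1, h2.2⟩

end Units

end GaloisUnits

end

noncomputable section

namespace GaloisUnits

/-! ### Ranks of invariant units -/

section Ranks

set_option maxSynthPendingDepth 3

open Polynomial

variable {L F : Type} [Field L] [NumberField L] [Field F] [NumberField F] [Algebra L F]

theorem unitsModTorsionHom_eq_zero_iff (u : Additive (𝓞 F)ˣ) :
    unitsModTorsionHom F u = 0 ↔ IsOfFinOrder u.toMul :=
  QuotientGroup.eq_one_iff (N := NumberField.Units.torsion F) u.toMul

variable (L F) in
/-- The norm on units modulo torsion. -/
def normModTorsion : UnitsModTorsion F →ₗ[ℤ] UnitsModTorsion L :=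
  (MonoidHom.toAdditive (QuotientGroup.map (NumberField.Units.torsion F)
    (NumberField.Units.torsion L) (Units.map (RingOfIntegers.norm L))
    (fun _ hu ↦ MonoidHom.isOfFinOrder _ hu))).toIntLinearMap

variable (L F) in
/-- The inclusion of units modulo torsion in an extension. -/
def inclModTorsion : UnitsModTorsion L →ₗ[ℤ] UnitsModTorsion F :=
  (MonoidHom.toAdditive (QuotientGroup.map (NumberField.Units.torsion L)
    (NumberField.Units.torsion F) (Units.map (algebraMap (𝓞 L) (𝓞 F) : 𝓞 L →* 𝓞 F))
    (fun _ hu ↦ MonoidHom.isOfFinOrder _ hu))).toIntLinearMap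

theorem inclModTorsion_normModTorsion [IsGalois L F] {s : Gal(F/L)}
    (hs : ∀ t, t ∈ Subgroup.zpowers s) (e : UnitsModTorsion F) :
    inclModTorsion L F (normModTorsion L F e) =
      ∑ i ∈ Finset.range (Nat.card Gal(F/L)), (galUnitsModTorsion s ^ i) e := by
  obtain ⟨u, rfl⟩ := unitsModTorsionHom_surjective e
  have h1 := congrArg (unitsModTorsionHom F) (sum_galUnitsAdd_pow hs u.toMul)
  rw [map_sum] at h1
  exact h1.symm.trans (Finset.sum_congr rfl fun i _ ↦ unitsModTorsionHom_pow s i u)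

theorem inclModTorsion_injective : Function.Injective (inclModTorsion L F) := by
  rw [injective_iff_map_eq_zero]
  intro e he
  obtain ⟨u, rfl⟩ := unitsModTorsionHom_surjective e
  obtain ⟨k, hk, h⟩ := ((unitsModTorsionHom_eq_zero_iff (Additive.ofMul (Units.map
    (algebraMap (𝓞 L) (𝓞 F) : 𝓞 L →* 𝓞 F) u.toMul))).1 he).exists_pow_eq_one
  refine (unitsModTorsionHom_eq_zero_iff u).2
    (isOfFinOrder_iff_pow_eq_one.2 ⟨k, hk, unitsMap_injective L F ?_⟩)
  rw [map_pow, map_one]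
  exact h

/-- On invariants, the norm followed by inclusion is multiplication by the degree, which is
injective on a torsion-free group. -/
theorem finrank_ker_sub_one_le [IsGalois L F] {s : Gal(F/L)}
    (hs : ∀ t, t ∈ Subgroup.zpowers s) :
    Module.finrank ℤ (LinearMap.ker (aeval (galUnitsModTorsion s) (X - 1 : ℤ[X]))) ≤
      NumberField.Units.rank L := by
  rw [← NumberField.Units.finrank_modTorsion]
  refine LinearMap.finrank_le_finrank_of_injective
    (f := (normModTorsion L F).domRestrict (LinearMap.ker _)) ?_
  rw [injective_iff_map_eq_zero]
  rintro ⟨e, he⟩ h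
  have h1 : galUnitsModTorsion s e = e := by
    have : aeval (galUnitsModTorsion s) (X - 1 : ℤ[X]) e = 0 := he
    simpa [sub_eq_zero] using this
  have h2 : ∀ i : ℕ, (galUnitsModTorsion s ^ i) e = e := fun i ↦ by
    induction i with
    | zero => rfl
    | succ i ih => rw [pow_succ, Module.End.mul_apply, h1, ih]
  have h3 := inclModTorsion_normModTorsion hs e
  have h4 : normModTorsion L F e = 0 := h
  simp_rw [h2] at h3
  rw [h4, map_zero, Finset.sum_const, Finset.card_range] at h3
  rw [← Nat.cast_smul_eq_nsmul ℤ] at h3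
  have h5 : e = 0 := (smul_eq_zero_iff_right
    (Nat.cast_ne_zero.2 (Nat.card_pos (α := Gal(F/L))).ne')).1 h3.symm
  exact Subtype.ext h5

theorem rank_le_finrank_ker (s : Gal(F/L)) (p : ℕ) (K : IntermediateField L F)
    (hK : ∀ x ∈ K, (s ^ p) x = x) :
    NumberField.Units.rank K ≤
      Module.finrank ℤ (LinearMap.ker (aeval (galUnitsModTorsion s) (X ^ p - 1 : ℤ[X]))) := by
  rw [← NumberField.Units.finrank_modTorsion]
  have h : ∀ e, inclModTorsion K F e ∈
      LinearMap.ker (aeval (galUnitsModTorsion s) (X ^ p - 1 : ℤ[X])) := fun e ↦ by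
    obtain ⟨u, rfl⟩ := unitsModTorsionHom_surjective e
    have h1 : (galUnitsModTorsion s ^ p) (inclModTorsion K F (unitsModTorsionHom K u)) =
        inclModTorsion K F (unitsModTorsionHom K u) := by
      change (galUnitsModTorsion s ^ p) (unitsModTorsionHom F (Additive.ofMul (Units.map
        (algebraMap (𝓞 K) (𝓞 F) : 𝓞 K →* 𝓞 F) u.toMul))) = unitsModTorsionHom F
          (Additive.ofMul (Units.map (algebraMap (𝓞 K) (𝓞 F) : 𝓞 K →* 𝓞 F) u.toMul))
      rw [← unitsModTorsionHom_pow, galUnitsAdd_pow_apply]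
      apply congrArg (fun w ↦ unitsModTorsionHom F (Additive.ofMul w))
      ext
      exact hK _ (((u.toMul : 𝓞 K) : K)).2
    rw [LinearMap.mem_ker]
    simp [h1]
  refine LinearMap.finrank_le_finrank_of_injective
    (f := (inclModTorsion K F).codRestrict _ h) fun a b hab ↦ ?_
  exact inclModTorsion_injective (congrArg Subtype.val hab)

/-- In odd degree `n` no infinite place ramifies, so `rank K = n (rank L + 1) - 1 ≥ n · rank L`. -/
theorem mul_rank_le_rank (K : Type) [Field K] [NumberField K] [Algebra L K] [IsGalois L K]
    (h : Odd (Module.finrank L K)) :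
    Module.finrank L K * NumberField.Units.rank L ≤ NumberField.Units.rank K := by
  have := IsUnramifiedAtInfinitePlaces_of_odd_finrank h
  rw [NumberField.Units.rank, NumberField.Units.rank,
    IsUnramifiedAtInfinitePlaces.card_infinitePlace L K, mul_comm, Nat.sub_mul, one_mul]
  exact Nat.sub_le_sub_left h.pos _

/-- The fixed field `K` of `s^p` has degree `p` over `L`; its units sit in `ker(s^p - 1)`, and `p ·
rank L ≤ rank K`. -/
theorem mul_finrank_ker_le [IsGalois L F] {s : Gal(F/L)} (hs : ∀ t, t ∈ Subgroup.zpowers s)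
    {p n : ℕ} (hp : Odd p) (hcard : Nat.card Gal(F/L) = p * n) :
    p * Module.finrank ℤ (LinearMap.ker (aeval (galUnitsModTorsion s) (X - 1 : ℤ[X]))) ≤
      Module.finrank ℤ (LinearMap.ker (aeval (galUnitsModTorsion s) (X ^ p - 1 : ℤ[X]))) := by
  have hn : 0 < n := Nat.pos_of_ne_zero fun h ↦
    (Nat.card_pos (α := Gal(F/L))).ne' (by rw [hcard, h, mul_zero])
  have hnormal : (Subgroup.zpowers (s ^ p)).Normal := by
    have : IsCyclic Gal(F/L) := ⟨s, hs⟩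
    have := IsCyclic.isMulCommutative (α := Gal(F/L))
    infer_instance
  let K : IntermediateField L F := IntermediateField.fixedField (Subgroup.zpowers (s ^ p))
  have h1 : Module.finrank K F = n := by
    rw [IntermediateField.finrank_fixedField_eq_card, Nat.card_zpowers, orderOf_pow,
      orderOf_eq_card_of_forall_mem_zpowers hs, hcard, Nat.gcd_mul_right_left,
      Nat.mul_div_cancel_left _ hp.pos]
  have h2 : Module.finrank L K = p := by
    have h3 := Module.finrank_mul_finrank L K F
    rw [h1, ← IsGalois.card_aut_eq_finrank L F, hcard] at h3
    exact Nat.eq_of_mul_eq_mul_right hn h3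
  have hgal : IsGalois L K := inferInstance
  have h4 := mul_rank_le_rank (L := L) K (h2 ▸ hp)
  rw [h2] at h4
  refine (Nat.mul_le_mul_left p (finrank_ker_sub_one_le hs)).trans
    (h4.trans (rank_le_finrank_ker s p K fun x hx ↦ ?_))
  exact hx ⟨s ^ p, Subgroup.mem_zpowers _⟩

end Ranks

end GaloisUnits

end

noncomputable section

namespace GaloisUnits

/-! ### The socle bound for the unit lattice -/

section Socle

set_option maxSynthPendingDepth 3

open Polynomial

variable {L F : Type} [Field L] [NumberField L] [Field F] [NumberField F] [Algebra L F]
  [IsGalois L F]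

/-- The socle of `H¹(S, 𝓔_F)` has at most `p ^ (2 * (r + δ))` elements. -/
theorem ncard_socle_moduleH1_le {p : ℕ} [Fact p.Prime] (hp : p ≠ 2) {Γ : Type} [CommGroup Γ]
    (hΓ : Nat.card Γ = p ^ 3) {S : Subgroup Γ} (hS : Nat.card S = p ^ 2) {σ : Γ}
    (hσ : ∀ x, x ∈ Subgroup.zpowers σ) (φ : Γ ≃* Gal(F/L)) (hN : NormTorsionEq L F) :
    {m : moduleH1 (unitRepOf p φ) S hS | p • m = 0 ∧ (MonoidAlgebra.single (σ : Γ ⧸ S) 1 :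
      MonoidAlgebra (ZMod (p ^ 2)) (Γ ⧸ S)) • m = m}.Finite ∧
    {m : moduleH1 (unitRepOf p φ) S hS | p • m = 0 ∧ (MonoidAlgebra.single (σ : Γ ⧸ S) 1 :
      MonoidAlgebra (ZMod (p ^ 2)) (Γ ⧸ S)) • m = m}.ncard ≤
        p ^ (2 * ((ramifiedPrimes L F).ncard + classGroupRank L p)) := by
  have hs : ∀ t, t ∈ Subgroup.zpowers (φ σ) := fun t ↦ by
    obtain ⟨k, hk⟩ := hσ (φ.symm t)
    exact ⟨k, by simpa using congrArg φ hk⟩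
  have hcard : Nat.card Gal(F/L) = p ^ 3 := by rw [← Nat.card_congr φ.toEquiv, hΓ]
  let ρ : Representation ℤ_[p] Γ (ℤ_[p] ⊗[ℤ] UnitsModTorsion F) :=
    (unitRep L F p).comp φ.toMonoidHom
  have hg : ρ σ = (galUnitsModTorsion (φ σ)).baseChange ℤ_[p] := rfl
  set x : MonoidAlgebra ℤ_[p] Γ := gr ℤ_[p] σ - 1 with hx
  obtain ⟨u, hu⟩ := exists_geom_eq (gr ℤ_[p] σ) p
  obtain ⟨v, hv⟩ := exists_geom_eq (gr ℤ_[p] σ ^ p) (p ^ 2)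
  obtain ⟨w, hw⟩ := exists_sub_one_pow_pred_eq (gr ℤ_[p] σ) p
  set T := geom (gr ℤ_[p] σ) p with hT
  set S' := geom (gr ℤ_[p] σ ^ p) (p ^ 2) with hS'
  have hxT : x * T = gr ℤ_[p] σ ^ p - 1 := sub_one_mul_geom _ _
  have hTS : T * S' = geom (gr ℤ_[p] σ) (p ^ 3) := by
    rw [hT, hS', geom_mul_geom, ← pow_succ']
  have h0 : x * T * S' = 0 := by
    have h1 : σ ^ p ^ 3 = 1 := by rw [← hΓ, pow_card_eq_one']
    rw [mul_assoc, hTS, sub_one_mul_geom, gr_pow, h1, sub_eq_zero]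
    rfl
  have hx1 : aeval (gr ℤ_[p] σ) (X - 1 : ℤ[X]) = x := by simp [hx]
  have hxp : aeval (gr ℤ_[p] σ) (X ^ p - 1 : ℤ[X]) = x * T := by simp [hxT]
  have hgeom : aeval (gr ℤ_[p] σ) (geom (X : ℤ[X]) (p ^ 3)) = T * S' := by
    rw [hTS]
    simp [geom]
  have hodd : Odd p := (Fact.out : p.Prime).odd_of_ne_two hp
  have hrank := mul_finrank_ker_le hs hodd (hcard.trans (pow_succ' p 2))
  rw [← finrank_kerMul_aeval hg, ← finrank_kerMul_aeval hg, hx1, hxp] at hrank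
  have hc := relIndex_baseChange_le hg (geom X (p ^ 3)) (X - 1) _
    (hcard ▸ relIndex_unitsModTorsion_le hs hN p)
  rw [hx1, hgeom] at hc
  have hfree : Module.Free ℤ_[p] ρ.asModule := Module.Free.of_equiv ρ.asModuleEquiv.symm
  have hfin : Module.Finite ℤ_[p] ρ.asModule := Module.Finite.equiv ρ.asModuleEquiv.symm
  -- The witness `T v` comes from `S' = p² + (σ^p - 1) v = p² + x (T v)`.
  have key := relIndex_socle_le_pow (A := ρ.asModule) x T S' u (T * v) w h0 hu
    (by rw [hv, ← hxT]; push_cast; ring) hw hrank _ hc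
  rw [hxT] at key
  exact ncard_socle_le hΓ hS σ hσ _ key

end Socle

end GaloisUnits

end

/-! ### The bound on the number of module structures -/

theorem mainTheorem6 (p : ℕ) [Fact p.Prime] (hp : p ≠ 2)
    (Γ : Type) [CommGroup Γ] [IsCyclic Γ] (hΓ : Nat.card Γ = p ^ 3)
    (Γ₂ : Subgroup Γ) (hΓ₂ : Nat.card Γ₂ = p ^ 2) (r δ : ℕ) :
    (GaloisUnits.possibleH1Structures p Γ₂ hΓ₂ r δ).Finite ∧
      (GaloisUnits.possibleH1Structures p Γ₂ hΓ₂ r δ).ncard ≤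
        p ^ (p * (6 * r + 4 * δ) ^ 2) * ((6 * r + 4 * δ + p).choose p) ^ 2 := by
  have hp0 := (Fact.out : p.Prime).pos
  have : Finite Γ := Nat.finite_of_card_ne_zero (by rw [hΓ]; positivity)
  obtain ⟨σ, hσ⟩ := IsCyclic.exists_generator (α := Γ)
  have hG : Nat.card (Γ ⧸ Γ₂) = p := by
    have h := Γ₂.card_eq_card_quotient_mul_card_subgroup
    rw [hΓ, hΓ₂, pow_succ'] at h
    exact (Nat.eq_of_mul_eq_mul_right (pow_pos hp0 2) h).symm
  have hg : ∀ x, x ∈ Subgroup.zpowers (σ : Γ ⧸ Γ₂) := fun x ↦ by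
    induction x using QuotientGroup.induction_on with
    | H y =>
      obtain ⟨k, rfl⟩ := hσ y
      exact ⟨k, rfl⟩
  obtain ⟨h1, h2⟩ := GaloisUnits.ncard_isoClasses_le hG (σ : Γ ⧸ Γ₂) hg (2 * (r + δ))
    (GaloisUnits.possibleH1Structures p Γ₂ hΓ₂ r δ) (by
      rintro c ⟨L, F, _, _, _, _, _, _, φ, hN, rfl, rfl, rfl⟩
      exact ⟨_, rfl, GaloisUnits.ncard_socle_moduleH1_le hp hΓ hΓ₂ hσ φ hN⟩)
  refine ⟨h1, h2.trans ?_⟩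
  -- The count already gives exponent `p (4r + 4δ)²`; enlarging `4r` to `6r` and inserting the
  -- binomial factor only weaken it.
  have h3 : 1 ≤ (6 * r + 4 * δ + p).choose p ^ 2 :=
    Nat.one_le_pow _ _ (Nat.choose_pos (Nat.le_add_left _ _))
  refine le_trans (Nat.pow_le_pow_right hp0 (Nat.mul_le_mul_left p (Nat.pow_le_pow_left ?_ 2)))
    (Nat.le_mul_of_pos_right _ h3)
  omega
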